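/- **Theorem 5 (minimax algorithm, Rademacher complexity).** Consider an episodic Markov decision process with horizon $H\ge 1$, measurable state space $\mathcal S$, finite nonempty action set $\mathcal A$, transition kernels $\mathbb P_h(\cdot\mid s,a)$ and deterministic measurable rewards $r_h:\mathcal S\times\mathcal A\to[0,1]$, $h\in[H]$. For $q:\mathcal S\times\mathcal A\to\mathbb R$ put $V_q(s)=\max_{a}q(s,a)$ and $(\mathcal T_h^\star q)(s,a)=r_h(s,a)+\mathbb E_{s'\sim\mathbb P_h(\cdot\mid s,a)}[V_q(s')]$. Let $\mu_h$ be a probability measure on $\mathcal S\times\mathcal A$, write $\|q\|_{\mu_h}^2=\mathbb E_{\mu_h}[q^2]$, and let $\nu_h$ be the law of $s'$ when $(s,a)\sim\mu_h$ and $s'\sim\mathbb P_h(\cdot\mid s,a)$. For each $h\in[H]$ the data consist of $n\ge1$ i.i.d. tuples $(s,a,r,s',h)$ with $(s,a)\sim\mu_h$, $r=r_h(s,a)$, $s'\sim\mathbb P_h(\cdot\mid s,a)$; $\mathcal D$ is the set of all $nH$ tuples. Let $\mathcal F=\mathcal F_1\times\cdots\times\mathcal F_H$ and $\mathcal G=\mathcal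 G_1\times\cdots\times\mathcal G_H$, where $\mathcal F_h,\mathcal G_h$ are nonempty classes of measurable functions $\mathcal S\times\mathcal A\to[-H,H]$, with the convention $f_{H+1}=0$, $\mathcal F_{H+1}=\{0\}$; to make suprema over the classes measurable, assume that each class contains a countable subclass from which every member of the class is the pointwise limit of a sequence. Define $$\mathcal E(f)=\frac1H\sum_{h=1}^H\|f_h-\mathcal T_h^\star f_{h+1}\|_{\mu_h}^2,$$ $$\hat L_{\mathrm{MM}}(f,g)=\frac1{nH}\sum_{(s,a,r,s',h)\in\mathcal D}\Big[\big(f_h(s,a)-r-V_{f_{h+1}}(s')\big)^2-\big(g_h(s,a)-r-V_{f_{h+1}}(s')\big)^2\Big].$$ For a class $\mathcal K$ of real functions and a probability measure $\rho$ let $\mathcal R_n^{\rho}(\mathcal K)=\mathbb E\big[\sup_{k\in\mathcal K}\frac1n\sum_{i=1}^n\sigma_ik(x_i)\big]$, where the $x_i\sim\rho$ are i.i.d. and the $\sigma_i$ are independent uniform signs, and let $V_{\mathcal F_{h+1}}=\{V_{q}: q\in\mathcal F_{h+1}\}$. There is an absolute constant $c>0$ such that the following holds in every such setting. Suppose that $\epsilon$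 satisfies, for all $h\in[H]$, $$\sup_{f_{h+1}\in\mathcal F_{h+1}}\ \inf_{g_h\in\mathcal G_h}\|g_h-\mathcal T_h^\star f_{h+1}\|_{\mu_h}^2\le\epsilon .$$ Then for every $\delta\in(0,1)$, with probability at least $1-\delta$, every minimax estimator $\hat f\in\arg\min_{f\in\mathcal F}\sup_{g\in\mathcal G}\hat L_{\mathrm{MM}}(f,g)$ satisfies $$\mathcal E(\hat f)\le\inf_{f\in\mathcal F}\mathcal E(f)+\epsilon+cH^2\sqrt{\frac{\log(1/\delta)}n}+c\sum_{h=1}^H\Big(\mathcal R_n^{\mu_h}(\mathcal F_h)+\mathcal R_n^{\mu_h}(\mathcal G_h)+\mathcal R_n^{\nu_h}(V_{\mathcal F_{h+1}})\Big).$$ -/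

import Mathlib

open MeasureTheory ProbabilityTheory Filter Topology

open scoped BigOperators

/-- An episodic Markov decision process with horizon `H`: at step `h` (steps are numbered
`0, …, H - 1`) there are a transition kernel to the next state and a deterministic measurable
reward function with values in `[0, 1]`. -/
structure EpisodicMDP (S A : Type*) [MeasurableSpace S] [MeasurableSpace A] (H : ℕ) where
  /-- `transition h (s, a)` is the law of the next state. -/
  transition : Fin H → Kernel (S × A) S
  /-- The reward function of step `h`. -/
  reward : Fin H → S × A → ℝ
  markov_transition : ∀ h, IsMarkovKernel (transition h)
  measurable_reward : ∀ h, Measurable (reward h)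
  reward_mem : ∀ h x, reward h x ∈ Set.Icc (0 : ℝ) 1

noncomputable section

/-- `V_q (s) = max_a q (s, a)`. -/
def greedyValue {S A : Type*} [Fintype A] [Nonempty A] (q : S × A → ℝ) (s : S) : ℝ :=
  Finset.univ.sup' Finset.univ_nonempty (fun a : A => q (s, a))

/-- The class `V_F = {V_q | q ∈ F}`. -/
def greedyValueClass {S A : Type*} [Fintype A] [Nonempty A] (F : Set (S × A → ℝ)) :
    Set (S → ℝ) :=
  greedyValue '' F

/-- The empirical Rademacher complexity of the class `F` at the points `x 1, …, x n`: the
expectation over i.i.d. uniform signs of `sup_{f ∈ F} (1 / n) ∑ i, σ i * f (x i)`. -/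
def empiricalRademacher {X : Type*} {n : ℕ} (F : Set (X → ℝ)) (x : Fin n → X) : ℝ :=
  (1 / 2 ^ n : ℝ) * ∑ σ : Fin n → ℤˣ,
    ⨆ f : F, (1 / n : ℝ) * ∑ i, ((σ i : ℤ) : ℝ) * (f : X → ℝ) (x i)

/-- The population Rademacher complexity: the expectation of the empirical one over `n`
i.i.d. points with law `ρ`. -/
def rademacher {X : Type*} [MeasurableSpace X] (n : ℕ) (ρ : Measure X) (F : Set (X → ℝ)) : ℝ :=
  ∫ x : Fin n → X, empiricalRademacher F x ∂(Measure.pi fun _ => ρ)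

/-- A pointwise measurable class: its members are measurable, and it has a countable subclass
from which each of its members is a pointwise limit of a sequence. This is the usual condition
under which suprema over the class are measurable. -/
def PointwiseMeasurableClass {X : Type*} [MeasurableSpace X] (F : Set (X → ℝ)) : Prop :=
  (∀ f ∈ F, Measurable f) ∧
    ∃ F₀ ⊆ F, F₀.Countable ∧ ∀ f ∈ F, ∃ u : ℕ → X → ℝ,
      (∀ k, u k ∈ F₀) ∧ ∀ x, Tendsto (fun k => u k x) atTop (𝓝 (f x))

namespace EpisodicMDP

variable {S A : Type*} [MeasurableSpace S] [MeasurableSpace A] [Fintype A] [Nonempty A] {H : ℕ}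

/-- The Bellman optimality operator of step `h`:
`(T q) (s, a) = r (s, a) + E [max_{a'} q (s', a') | s, a]`. -/
def bellman (M : EpisodicMDP S A H) (h : Fin H) (q : S × A → ℝ) (x : S × A) : ℝ :=
  M.reward h x + ∫ s', greedyValue q s' ∂(M.transition h x)

/-- The Bellman error `(1 / H) ∑ h, ‖f_h - T_h f_{h+1}‖²_{μ_h}`. A tuple `f` is indexed by
`Fin (H + 1)`: `f h.castSucc` is `f_h`, `f h.succ` is `f_{h+1}`, and the last entry is the
function of the step after the horizon. -/
def bellmanError (M : EpisodicMDP S A H) (μ : Fin H → Measure (S × A))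
    (f : Fin (H + 1) → S × A → ℝ) : ℝ :=
  (1 / H : ℝ) * ∑ h : Fin H, ∫ x, (f h.castSucc x - M.bellman h (f h.succ) x) ^ 2 ∂(μ h)

/-- The law of a data point `((s, a), s')` of step `h`: `(s, a)` has law `μ_h` and `s'` is drawn
from the transition kernel at `(s, a)`. -/
def sampleLaw (M : EpisodicMDP S A H) (μ : Fin H → Measure (S × A)) (h : Fin H) :
    Measure ((S × A) × S) :=
  μ h ⊗ₘ M.transition h

/-- The marginal law `ν_h` of the next state `s'` in a data point of step `h`. -/
def nextStateLaw (M : EpisodicMDP S A H) (μ : Fin H → Measure (S × A)) (h : Fin H) :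
    Measure S :=
  (M.sampleLaw μ h).snd

/-- The squared loss `(q (s, a) - r (s, a) - V_{q'} (s'))²` at a data point `z = ((s, a), s')`
of step `h`; the recorded reward is the deterministic reward at `(s, a)`. -/
def sqLoss (M : EpisodicMDP S A H) (h : Fin H) (q q' : S × A → ℝ) (z : (S × A) × S) : ℝ :=
  (q z.1 - M.reward h z.1 - greedyValue q' z.2) ^ 2

/-- The empirical minimax loss of `(f, g)` on a data set `d` with `n` data points per step. -/
def minimaxLoss {n : ℕ} (M : EpisodicMDP S A H) (d : Fin H → Fin n → (S × A) × S)
    (f : Fin (H + 1) → S × A → ℝ) (g : Fin H → S × A → ℝ) : ℝ :=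
  (1 / (n * H) : ℝ) * ∑ h : Fin H, ∑ i : Fin n,
    (M.sqLoss h (f h.castSucc) (f h.succ) (d h i) - M.sqLoss h (g h) (f h.succ) (d h i))

/-- `fhat` is a minimax estimator on the data set `d`: it minimizes
`f ↦ sup_{g ∈ G} minimaxLoss d f g` over the product class `F`. -/
def IsMinimaxEstimator {n : ℕ} (M : EpisodicMDP S A H) (F : Fin (H + 1) → Set (S × A → ℝ))
    (G : Fin H → Set (S × A → ℝ)) (d : Fin H → Fin n → (S × A) × S)
    (fhat : Fin (H + 1) → S × A → ℝ) : Prop :=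
  fhat ∈ Set.univ.pi F ∧ ∀ f ∈ Set.univ.pi F,
    (⨆ g : Set.univ.pi G, M.minimaxLoss d fhat g) ≤ ⨆ g : Set.univ.pi G, M.minimaxLoss d f g

end EpisodicMDP

end

/-! For fixed functions, `lossGap` has mean ‖f_h − T f_{h+1}‖² − ‖g_h − T f_{h+1}‖²
(`integral_lossGap`): the conditional variance of the regression target, which biases the plain
squared loss, cancels. Play the estimator against a helper g close to its Bellman image, and a
comparator f against a nearly maximizing helper g'. Minimality orders the two empirical losses, the
choice of g costs ε, and ‖g'_h − T f_{h+1}‖² enters with the favourable sign. What remains at each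
step is the deviation of one gap minus the deviation of another (`bellmanError_le_of_deviation_le`);
this part is deterministic.

At each step such differences are dominated by one statistic W_h, the uniform deviation over pairs
of triples (f, g, q) (`exists_subgaussian_deviation_bound`). Its mean is bounded by symmetrization
(`integral_uniformDeviation_le`) and contraction (`signAverage_le_of_contraction`): the squared loss
is a 6H-Lipschitz function of the residual f − r − V, which is additive in f and V, so the
complexity of the product class splits into a sum. The factor H is absorbed by the 1/H in the
Bellman error.

The fluctuation of W_h is sub-Gaussian with parameter of order H⁴/n, by bounded differences.
Convexity of the exponential keeps that parameter for the average over steps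
(`HasSubgaussianMGF.average`), so there is no union bound, no log H, and no need for independence
between steps. Suprema are taken over countable dense subclasses, and the bounds reach the full
classes by pointwise limits. -/

namespace ProbabilityTheory

/-! ### Sub-Gaussian tools: bounded differences and averages. -/

/-- **McDiarmid's inequality** in sub-Gaussian form: a bounded function of `n` i.i.d. points that
changes by at most `c` when one of the points is replaced is sub-Gaussian about its mean. -/
theorem hasSubgaussianMGF_of_bounded_differences {Z : Type*} [MeasurableSpace Z] (ρ : Measure Z)
    [IsProbabilityMeasure ρ] {c C : ℝ} (n : ℕ) (f : (Fin n → Z) → ℝ)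
    (hf : Measurable f) (hb : ∀ x, |f x| ≤ C)
    (hd : ∀ x i z, |f (Function.update x i z) - f x| ≤ c) :
    HasSubgaussianMGF (fun x => f x - ∫ y, f y ∂(Measure.pi fun _ => ρ)) (n * ‖c‖₊ ^ 2)
      (Measure.pi fun _ => ρ) := by
  induction n with
  | zero =>
    have h : ∀ x, f x - ∫ y, f y ∂(Measure.pi fun _ => ρ) = 0 := by
      intro x
      have : ∀ y, f y = f x := fun y => by rw [Subsingleton.elim y x]
      simp [this]
    simp only [h, Nat.cast_zero, zero_mul]
    exact HasSubgaussianMGF.fun_zero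
  | succ n ih =>
    set π : Measure (Fin n → Z) := Measure.pi fun _ => ρ
    have he := measurePreserving_piFinSuccAbove (fun _ : Fin (n + 1) => ρ) 0
    set e := MeasurableEquiv.piFinSuccAbove (fun _ : Fin (n + 1) => Z) 0
    set F : Z × (Fin n → Z) → ℝ := fun p => f (Fin.cons p.1 p.2) with hF
    have hes : ∀ p, e.symm p = Fin.cons p.1 p.2 := by
      intro p
      simp only [e, MeasurableEquiv.piFinSuccAbove_symm_apply, Fin.insertNthEquiv_zero]
      rfl
    have hFe : ∀ x, F (e x) = f x := by
      intro x
      rw [hF]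
      simp only
      rw [← hes, e.symm_apply_apply]
    have hFm : Measurable F := by
      have : F = f ∘ e.symm := by
        funext p
        simp only [Function.comp, hes, hF]
      rw [this]
      exact hf.comp e.symm.measurable
    have hFb : ∀ p, |F p| ≤ C := fun p => hb _
    have hFi : Integrable F (ρ.prod π) :=
      Integrable.of_bound hFm.aestronglyMeasurable C (ae_of_all _ hFb)
    have hmean : ∫ y, f y ∂(Measure.pi fun _ : Fin (n + 1) => ρ) = ∫ p, F p ∂(ρ.prod π) := by
      rw [← he.integral_comp']
      simp_rw [hFe]
    set M := ∫ p, F p ∂(ρ.prod π) with hM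
    set m : Z → ℝ := fun z => ∫ y, F (z, y) ∂π with hm
    have hmM : M = ∫ z, m z ∂ρ := integral_prod _ hFi
    have hmm : Measurable m := (hFm.stronglyMeasurable.integral_prod_right (ν := π)).measurable
    have hsec : ∀ z, Integrable (fun y => F (z, y)) π := fun z =>
      Integrable.of_bound (hFm.comp measurable_prodMk_left).aestronglyMeasurable C
        (ae_of_all _ fun y => hFb _)
    have hmd : ∀ z z', |m z - m z'| ≤ c := by
      intro z z'
      rw [hm]
      simp only
      rw [← integral_sub (hsec z) (hsec z')]
      have hle : ∀ᵐ y ∂π, ‖F (z, y) - F (z', y)‖ ≤ c := ae_of_all _ fun y => by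
        have := hd (Fin.cons z' y) 0 z
        rwa [Fin.update_cons_zero] at this
      simpa using norm_integral_le_of_norm_le_const hle
    have hZ : Nonempty Z := nonempty_of_isProbabilityMeasure ρ
    obtain ⟨z₀⟩ := hZ
    have h1 : HasSubgaussianMGF (fun z => m z - M) (‖c‖₊ ^ 2) ρ := by
      -- Centring at `m z₀` gives an interval of length 2c, hence the parameter c² instead of the
      -- sharp c²/4; only the absolute constant suffers.
      have := hasSubgaussianMGF_of_mem_Icc (μ := ρ) (X := m) (a := m z₀ - c) (b := m z₀ + c)
        hmm.aemeasurable (ae_of_all _ fun z => by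
          have := abs_le.1 (hmd z z₀)
          constructor <;> linarith [this.1, this.2])
      rw [hmM]
      convert this using 2
      rw [show m z₀ + c - (m z₀ - c) = 2 * c by ring, nnnorm_mul]
      simp
    have h2 : ∀ z, HasSubgaussianMGF (fun y => F (z, y) - m z) (n * ‖c‖₊ ^ 2) π := by
      intro z
      refine ih (fun y => F (z, y)) (hFm.comp measurable_prodMk_left) (fun y => hFb _) ?_
      intro y i w
      have := hd (Fin.cons z y) i.succ w
      rwa [← Fin.cons_update] at this
    have h3 : HasSubgaussianMGF (fun p => F p - M) ((n + 1 : ℕ) * ‖c‖₊ ^ 2) (ρ.prod π) := by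
      have hint : ∀ t : ℝ, Integrable (fun p => Real.exp (t * (F p - M))) (ρ.prod π) := fun t =>
        integrable_exp_mul_of_mem_Icc (a := -C - M) (b := C - M)
          (hFm.sub_const M).aemeasurable (ae_of_all _ fun p => by
            have := abs_le.1 (hFb p)
            constructor <;> linarith [this.1, this.2])
      refine ⟨hint, fun t => ?_⟩
      rw [mgf, integral_prod _ (hint t)]
      -- Conditionally on the first point, F − M = (F − m z) + (m z − M). The inductive bound on the
      -- first summand is uniform in `z`, so the two exponential moments multiply.
      have hin : ∀ z, ∫ y, Real.exp (t * (F (z, y) - M)) ∂π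
          ≤ Real.exp ((n * ‖c‖₊ ^ 2 : NNReal) * t ^ 2 / 2) * Real.exp (t * (m z - M)) := by
        intro z
        have : ∀ y, Real.exp (t * (F (z, y) - M))
            = Real.exp (t * (F (z, y) - m z)) * Real.exp (t * (m z - M)) := by
          intro y
          rw [← Real.exp_add]
          ring_nf
        simp_rw [this]
        rw [integral_mul_const]
        exact mul_le_mul_of_nonneg_right ((h2 z).mgf_le t) (Real.exp_pos _).le
      calc _ ≤ ∫ z, Real.exp ((n * ‖c‖₊ ^ 2 : NNReal) * t ^ 2 / 2) * Real.exp (t * (m z - M)) ∂ρ :=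
            integral_mono (hint t).integral_prod_left ((h1.integrable_exp_mul t).const_mul _) hin
        _ ≤ Real.exp ((n * ‖c‖₊ ^ 2 : NNReal) * t ^ 2 / 2)
              * Real.exp ((‖c‖₊ ^ 2 : NNReal) * t ^ 2 / 2) := by
            rw [integral_const_mul]
            exact mul_le_mul_of_nonneg_left (h1.mgf_le t) (Real.exp_pos _).le
        _ = _ := by
            rw [← Real.exp_add]
            congr 1
            push_cast
            ring
    rw [hmean]
    have h4 : HasSubgaussianMGF (fun p => F p - M) ((n + 1 : ℕ) * ‖c‖₊ ^ 2)
        ((Measure.pi fun _ : Fin (n + 1) => ρ).map e) := by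
      rw [he.map_eq]
      exact h3
    have h5 := HasSubgaussianMGF.of_map e.measurable.aemeasurable h4
    refine h5.congr (ae_of_all _ fun x => ?_)
    simp only [Function.comp, hFe]

/-- The average of sub-Gaussian random variables with a common parameter is sub-Gaussian with that
parameter, whatever their joint law. -/
theorem HasSubgaussianMGF.average {Ω ι : Type*} [MeasurableSpace Ω] {P : Measure Ω} [Fintype ι]
    [Nonempty ι] {X : ι → Ω → ℝ} {v : NNReal} (hX : ∀ i, HasSubgaussianMGF (X i) v P) :
    HasSubgaussianMGF (fun ω => (1 / Fintype.card ι : ℝ) * ∑ i, X i ω) v P := by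
  have hcard : (0 : ℝ) < Fintype.card ι := by exact_mod_cast Fintype.card_pos
  have hle : ∀ (t : ℝ) ω, Real.exp (t * ((1 / Fintype.card ι : ℝ) * ∑ i, X i ω))
      ≤ ∑ i, (1 / Fintype.card ι : ℝ) * Real.exp (t * X i ω) := by
    intro t ω
    -- Jensen with uniform weights, pointwise in ω: the joint law never enters.
    have := convexOn_exp.map_sum_le (t := Finset.univ) (w := fun _ : ι => (1 / Fintype.card ι : ℝ))
      (p := fun i => t * X i ω) (fun _ _ => by positivity) (by simp) (fun _ _ => Set.mem_univ _)
    simp only [smul_eq_mul] at this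
    refine le_trans (le_of_eq ?_) this
    rw [Finset.mul_sum, Finset.mul_sum]
    exact congrArg _ (Finset.sum_congr rfl fun i _ => by ring)
  have hdom : ∀ t : ℝ, Integrable (fun ω => ∑ i, (1 / Fintype.card ι : ℝ) * Real.exp (t * X i ω)) P :=
    fun t => integrable_finsetSum _ fun i _ => ((hX i).integrable_exp_mul t).const_mul _
  have hint : ∀ t : ℝ, Integrable
      (fun ω => Real.exp (t * ((1 / Fintype.card ι : ℝ) * ∑ i, X i ω))) P := by
    intro t
    refine (hdom t).mono' ?_ (ae_of_all _ fun ω => ?_)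
    · have : AEMeasurable (fun ω => ∑ i, X i ω) P :=
        Finset.aemeasurable_fun_sum _ fun i _ => (hX i).aemeasurable
      exact (Real.measurable_exp.comp_aemeasurable
        ((this.const_mul _).const_mul t)).aestronglyMeasurable
    · rw [Real.norm_of_nonneg (Real.exp_pos _).le]
      exact hle t ω
  refine ⟨hint, fun t => ?_⟩
  calc _ ≤ ∫ ω, ∑ i, (1 / Fintype.card ι : ℝ) * Real.exp (t * X i ω) ∂P :=
        integral_mono (hint t) (hdom t) (hle t)
    _ = ∑ i, (1 / Fintype.card ι : ℝ) * mgf (X i) P t := by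
        rw [integral_finsetSum _ fun i _ => ((hX i).integrable_exp_mul t).const_mul _]
        simp_rw [integral_const_mul, mgf]
    _ ≤ ∑ _i : ι, (1 / Fintype.card ι : ℝ) * Real.exp (v * t ^ 2 / 2) :=
        Finset.sum_le_sum fun i _ => mul_le_mul_of_nonneg_left ((hX i).mgf_le t) (by positivity)
    _ = _ := by
        rw [Finset.sum_const, Finset.card_univ, nsmul_eq_mul]
        field_simp

end ProbabilityTheory

/-! ### Sign averages and the contraction principle. -/

noncomputable section

/-- The average over all sign vectors of `sup_t (1 / n) ∑ i, σ i * u t i`: the Rademacher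
complexity of an indexed set of vectors. -/
def signAverage {ι : Type*} {n : ℕ} (u : ι → Fin n → ℝ) : ℝ :=
  (1 / 2 ^ n : ℝ) * ∑ σ : Fin n → ℤˣ, ⨆ t, (1 / n : ℝ) * ∑ i, ((σ i : ℤ) : ℝ) * u t i

end

lemma abs_units_int_cast (s : ℤˣ) : |((s : ℤ) : ℝ)| = 1 := by
  rcases Int.units_eq_one_or s with h | h <;> simp [h]

lemma abs_sum_sign_mul_le {n : ℕ} {B : ℝ} {u : Fin n → ℝ} (hu : ∀ i, |u i| ≤ B) (σ : Fin n → ℤˣ) :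
    |∑ i, ((σ i : ℤ) : ℝ) * u i| ≤ n * B := by
  refine (Finset.abs_sum_le_sum_abs _ _).trans ?_
  refine (Finset.sum_le_sum (g := fun _ => B) fun i _ => ?_).trans (by simp)
  rw [abs_mul, abs_units_int_cast, one_mul]
  exact hu i

lemma abs_sign_mean_le {n : ℕ} {B : ℝ} {u : Fin n → ℝ} (hB : 0 ≤ B) (hu : ∀ i, |u i| ≤ B)
    (σ : Fin n → ℤˣ) : |(1 / n : ℝ) * ∑ i, ((σ i : ℤ) : ℝ) * u i| ≤ B := by
  rw [abs_mul, abs_of_nonneg (by positivity : (0 : ℝ) ≤ 1 / n)]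
  refine (mul_le_mul_of_nonneg_left (abs_sum_sign_mul_le hu σ) (by positivity)).trans ?_
  rcases Nat.eq_zero_or_pos n with h | h
  · simpa [h] using hB
  · have : (0 : ℝ) < n := by exact_mod_cast h
    field_simp
    exact le_rfl

lemma bddAbove_range_of_abs_le {ι : Type*} {C : ℝ} {f : ι → ℝ} (h : ∀ t, |f t| ≤ C) :
    BddAbove (Set.range f) :=
  ⟨C, by rintro _ ⟨t, rfl⟩; exact (abs_le.1 (h t)).2⟩

lemma abs_iSup_le {ι : Type*} [Nonempty ι] {C : ℝ} {f : ι → ℝ} (h : ∀ t, |f t| ≤ C) :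
    |⨆ t, f t| ≤ C := by
  refine abs_le.2 ⟨?_, ciSup_le fun t => (abs_le.1 (h t)).2⟩
  exact (abs_le.1 (h (Classical.arbitrary ι))).1.trans (le_ciSup (bddAbove_range_of_abs_le h) _)

lemma iSup_add_le_of_bddAbove {ι : Type*} [Nonempty ι] {f g : ι → ℝ} (hf : BddAbove (Set.range f))
    (hg : BddAbove (Set.range g)) : ⨆ t, (f t + g t) ≤ (⨆ t, f t) + ⨆ t, g t :=
  ciSup_le fun t => add_le_add (le_ciSup hf t) (le_ciSup hg t)

section SignAverage

variable {ι κ : Type*} {n : ℕ} {B : ℝ}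

lemma bddAbove_sign_mean (hB : 0 ≤ B) {u : ι → Fin n → ℝ} (hu : ∀ t i, |u t i| ≤ B)
    (σ : Fin n → ℤˣ) :
    BddAbove (Set.range fun t => (1 / n : ℝ) * ∑ i, ((σ i : ℤ) : ℝ) * u t i) :=
  bddAbove_range_of_abs_le fun t => abs_sign_mean_le hB (hu t) σ

lemma abs_signAverage_le [Nonempty ι] (hB : 0 ≤ B) {u : ι → Fin n → ℝ}
    (hu : ∀ t i, |u t i| ≤ B) : |signAverage u| ≤ B := by
  rw [signAverage, abs_mul, abs_of_nonneg (by positivity : (0 : ℝ) ≤ 1 / 2 ^ n)]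
  have : |∑ σ : Fin n → ℤˣ, ⨆ t, (1 / n : ℝ) * ∑ i, ((σ i : ℤ) : ℝ) * u t i| ≤ 2 ^ n * B := by
    refine (Finset.abs_sum_le_sum_abs _ _).trans ?_
    refine (Finset.sum_le_sum (g := fun _ => B) fun σ _ =>
      abs_iSup_le fun t => abs_sign_mean_le hB (hu t) σ).trans ?_
    simp
  refine (mul_le_mul_of_nonneg_left this (by positivity)).trans ?_
  field_simp
  exact le_rfl

lemma signAverage_comp_le [Nonempty ι] (hB : 0 ≤ B) {u : κ → Fin n → ℝ}
    (hu : ∀ t i, |u t i| ≤ B) (g : ι → κ) : signAverage (fun t => u (g t)) ≤ signAverage u := by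
  refine mul_le_mul_of_nonneg_left (Finset.sum_le_sum fun σ _ => ?_) (by positivity)
  exact ciSup_le fun t => le_ciSup (bddAbove_sign_mean hB hu σ) (g t)

lemma signAverage_add_le [Nonempty ι] (hB : 0 ≤ B) {u v : ι → Fin n → ℝ}
    (hu : ∀ t i, |u t i| ≤ B) (hv : ∀ t i, |v t i| ≤ B) :
    signAverage (fun t i => u t i + v t i) ≤ signAverage u + signAverage v := by
  rw [signAverage, signAverage, signAverage, ← mul_add, ← Finset.sum_add_distrib]
  refine mul_le_mul_of_nonneg_left (Finset.sum_le_sum fun σ _ => ?_) (by positivity)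
  simp only [mul_add, Finset.sum_add_distrib]
  exact iSup_add_le_of_bddAbove (bddAbove_sign_mean hB hu σ) (bddAbove_sign_mean hB hv σ)

lemma signAverage_const_mul {c : ℝ} (hc : 0 ≤ c) (u : ι → Fin n → ℝ) :
    signAverage (fun t i => c * u t i) = c * signAverage u := by
  have h : ∀ σ : Fin n → ℤˣ, (⨆ t, (1 / n : ℝ) * ∑ i, ((σ i : ℤ) : ℝ) * (c * u t i))
      = c * ⨆ t, (1 / n : ℝ) * ∑ i, ((σ i : ℤ) : ℝ) * u t i := by
    intro σ
    rw [Real.mul_iSup_of_nonneg hc]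
    refine iSup_congr fun t => ?_
    rw [mul_left_comm c, Finset.mul_sum Finset.univ _ c]
    exact congrArg _ (Finset.sum_congr rfl fun i _ => mul_left_comm _ _ _)
  simp only [signAverage, h]
  rw [← Finset.mul_sum, mul_left_comm]

/-- The case of one sign in the contraction principle. For indices t, s the left side is at most b t
+ b s + |v t − v s|; according to the sign of v t − v s, one of t, s is a candidate for the supremum
with + and the other for the one with −. -/
lemma iSup_add_add_iSup_sub_le [Nonempty ι] {b w v : ι → ℝ}
    (hp : BddAbove (Set.range fun t => b t + v t)) (hm : BddAbove (Set.range fun t => b t - v t))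
    (h : ∀ t s, |w t - w s| ≤ |v t - v s|) :
    (⨆ t, (b t + w t)) + ⨆ t, (b t - w t) ≤ (⨆ t, (b t + v t)) + ⨆ t, (b t - v t) := by
  have key : ∀ t s, (b t + w t) + (b s - w s) ≤ (⨆ t, (b t + v t)) + ⨆ t, (b t - v t) := by
    intro t s
    have h1 := (abs_le.1 (h t s)).2
    have := le_ciSup hp t
    have := le_ciSup hp s
    have := le_ciSup hm t
    have := le_ciSup hm s
    rcases abs_cases (v t - v s) with ⟨h2, _⟩ | ⟨h2, _⟩ <;> linarith
  have h1 : ∀ s, (⨆ t, (b t + w t)) ≤ (⨆ t, (b t + v t)) + (⨆ t, (b t - v t)) - (b s - w s) :=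
    fun s => ciSup_le fun t => by linarith [key t s]
  have h2 : (⨆ s, (b s - w s)) ≤ (⨆ t, (b t + v t)) + (⨆ t, (b t - v t)) - ⨆ t, (b t + w t) :=
    ciSup_le fun s => by linarith [h1 s]
  linarith

lemma sum_units_int {f : ℤˣ → ℝ} : ∑ s, f s = f 1 + f (-1) := by
  rw [UnitsInt.univ, Finset.sum_pair (by decide)]

/-- Coordinates are exchanged one at a time. The arbitrary offset `a` makes the induction close: it
absorbs the first coordinate while the others are replaced; then, with the other signs fixed, the
two values of the first sign are paired. With no absolute value inside the supremum, no
normalization at zero is needed. -/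
lemma sum_iSup_add_sign_le [Nonempty ι] {A : ℝ} (a : ι → ℝ) (w v : ι → Fin n → ℝ)
    (ha : ∀ t, |a t| ≤ A) (hw : ∀ t i, |w t i| ≤ B) (hv : ∀ t i, |v t i| ≤ B)
    (h : ∀ t s i, |w t i - w s i| ≤ |v t i - v s i|) :
    ∑ σ : Fin n → ℤˣ, ⨆ t, (a t + ∑ i, ((σ i : ℤ) : ℝ) * w t i)
      ≤ ∑ σ : Fin n → ℤˣ, ⨆ t, (a t + ∑ i, ((σ i : ℤ) : ℝ) * v t i) := by
  induction n generalizing a A with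
  | zero => simp
  | succ n ih =>
    have hsplit : ∀ u : ι → Fin (n + 1) → ℝ,
        ∑ σ : Fin (n + 1) → ℤˣ, ⨆ t, (a t + ∑ i, ((σ i : ℤ) : ℝ) * u t i)
          = ∑ s : ℤˣ, ∑ τ : Fin n → ℤˣ,
              ⨆ t, (a t + ((s : ℤ) : ℝ) * u t 0 + ∑ i, ((τ i : ℤ) : ℝ) * u t i.succ) := by
      intro u
      rw [← (Fin.consEquiv fun _ => ℤˣ).sum_comp, Fintype.sum_prod_type]
      refine Finset.sum_congr rfl fun s _ => Finset.sum_congr rfl fun τ _ => ?_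
      refine iSup_congr fun t => ?_
      simp only [Fin.consEquiv, Equiv.coe_fn_mk, Fin.sum_univ_succ, Fin.cons_zero, Fin.cons_succ]
      ring
    rw [hsplit, hsplit]
    calc _ ≤ ∑ s : ℤˣ, ∑ τ : Fin n → ℤˣ,
              ⨆ t, (a t + ((s : ℤ) : ℝ) * w t 0 + ∑ i, ((τ i : ℤ) : ℝ) * v t i.succ) := by
          refine Finset.sum_le_sum fun s _ => ?_
          refine ih (A := A + B) (fun t => a t + ((s : ℤ) : ℝ) * w t 0) (fun t i => w t i.succ)
            (fun t i => v t i.succ) (fun t => ?_) (fun t i => hw t _) (fun t i => hv t _)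
            (fun t s i => h t s _)
          refine (abs_add_le _ _).trans (add_le_add (ha t) ?_)
          rw [abs_mul, abs_units_int_cast, one_mul]
          exact hw t 0
      _ ≤ _ := by
          rw [Finset.sum_comm, Finset.sum_comm (s := (Finset.univ : Finset ℤˣ))]
          refine Finset.sum_le_sum fun τ _ => ?_
          rw [sum_units_int, sum_units_int]
          have hbd : ∀ t, |a t + ∑ i, ((τ i : ℤ) : ℝ) * v t i.succ| ≤ A + n * B := fun t =>
            (abs_add_le _ _).trans (add_le_add (ha t) (abs_sum_sign_mul_le (fun i => hv t _) τ))
          have := iSup_add_add_iSup_sub_le (b := fun t => a t + ∑ i, ((τ i : ℤ) : ℝ) * v t i.succ)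
            (w := fun t => w t 0) (v := fun t => v t 0)
            (bddAbove_range_of_abs_le fun t => (abs_add_le _ _).trans (add_le_add (hbd t) (hv t 0)))
            (bddAbove_range_of_abs_le fun t => (abs_sub _ _).trans (add_le_add (hbd t) (hv t 0)))
            (fun t s => h t s 0)
          have h1 : ∀ (s : ℤˣ) (u : ι → Fin (n + 1) → ℝ) (t : ι),
              a t + ((s : ℤ) : ℝ) * u t 0 + ∑ i, ((τ i : ℤ) : ℝ) * v t i.succ
                = a t + ∑ i, ((τ i : ℤ) : ℝ) * v t i.succ + ((s : ℤ) : ℝ) * u t 0 :=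
            fun s u t => by ring
          simp only [h1]
          simpa [sub_eq_add_neg] using this

/-- The **contraction principle**. -/
theorem signAverage_le_of_contraction [Nonempty ι] (w v : ι → Fin n → ℝ)
    (hw : ∀ t i, |w t i| ≤ B) (hv : ∀ t i, |v t i| ≤ B)
    (h : ∀ t s i, |w t i - w s i| ≤ |v t i - v s i|) : signAverage w ≤ signAverage v := by
  refine mul_le_mul_of_nonneg_left ?_ (by positivity)
  simp_rw [← Real.mul_iSup_of_nonneg (by positivity : (0 : ℝ) ≤ 1 / n), ← Finset.mul_sum]
  refine mul_le_mul_of_nonneg_left ?_ (by positivity)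
  simpa using sum_iSup_add_sign_le (A := 0) (fun _ => 0) w v (by simp) hw hv h

/-- Negation is an isometry of the line, so this is a case of contraction. -/
lemma signAverage_neg_le [Nonempty ι] {u : ι → Fin n → ℝ} (hu : ∀ t i, |u t i| ≤ B) :
    signAverage (fun t i => -u t i) ≤ signAverage u :=
  signAverage_le_of_contraction _ _ (by simpa using hu) hu fun t s i => by
    rw [← abs_neg]
    exact le_of_eq (congrArg _ (by ring))

/-- The zero family is a contraction of every family. The bound is raised to `max B 0` because `B`
may be negative when `n = 0`. -/
lemma signAverage_nonneg [Nonempty ι] {u : ι → Fin n → ℝ} (hu : ∀ t i, |u t i| ≤ B) :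
    0 ≤ signAverage u := by
  have hB : 0 ≤ max B 0 := le_max_right _ _
  have := signAverage_le_of_contraction (B := max B 0) (fun (_ : ι) (_ : Fin n) => 0) u
    (by simp) (fun t i => (hu t i).trans (le_max_left _ _)) (by simp)
  simpa [signAverage] using this

end SignAverage

/-! ### Uniform deviations and symmetrization. -/

section Symmetrization

lemma measurable_signAverage {ι Y : Type*} [Countable ι] [MeasurableSpace Y] {n : ℕ}
    {u : Y → ι → Fin n → ℝ} (hu : ∀ t i, Measurable fun y => u y t i) :
    Measurable fun y => signAverage (u y) := by
  refine (Finset.measurable_fun_sum _ fun σ _ => ?_).const_mul _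
  exact Measurable.iSup fun t =>
    (Finset.measurable_fun_sum _ fun i _ => (hu t i).const_mul _).const_mul _

variable {ι Z : Type*} [Countable ι] [Nonempty ι] [MeasurableSpace Z] {n : ℕ} {B : ℝ}

lemma integrable_signAverage {Y : Type*} [MeasurableSpace Y] (P : Measure Y) [IsFiniteMeasure P]
    (hB : 0 ≤ B) {u : Y → ι → Fin n → ℝ} (hu : ∀ t i, Measurable fun y => u y t i)
    (hb : ∀ y t i, |u y t i| ≤ B) : Integrable (fun y => signAverage (u y)) P :=
  Integrable.of_bound (measurable_signAverage hu).aestronglyMeasurable B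
    (ae_of_all _ fun y => abs_signAverage_le hB (hb y))

/-- The largest amount by which the mean of a member of the family `d` exceeds its empirical
mean. -/
noncomputable def uniformDeviation {ι Z : Type*} [MeasurableSpace Z] {n : ℕ} (ρ : Measure Z)
    (d : ι → Z → ℝ) (x : Fin n → Z) : ℝ :=
  ⨆ t, (∫ z, d t z ∂ρ - (1 / n : ℝ) * ∑ i, d t (x i))

lemma measurable_uniformDeviation {ι Z : Type*} [Countable ι] [MeasurableSpace Z] {n : ℕ}
    (ρ : Measure Z) {d : ι → Z → ℝ} (hd : ∀ t, Measurable (d t)) :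
    Measurable (uniformDeviation (n := n) ρ d) :=
  Measurable.iSup fun t => measurable_const.sub
    ((Finset.measurable_fun_sum _ fun i _ => (hd t).comp (measurable_pi_apply i)).const_mul _)

lemma abs_mean_le {n : ℕ} {u : Fin n → ℝ} (hB : 0 ≤ B) (hu : ∀ i, |u i| ≤ B) :
    |(1 / n : ℝ) * ∑ i, u i| ≤ B := by
  simpa using abs_sign_mean_le hB hu 1

lemma abs_integral_le_of_abs_le {Z : Type*} [MeasurableSpace Z] (ρ : Measure Z)
    [IsProbabilityMeasure ρ] {f : Z → ℝ} (hf : ∀ z, |f z| ≤ B) : |∫ z, f z ∂ρ| ≤ B := by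
  have h : ∀ᵐ z ∂ρ, ‖f z‖ ≤ B := ae_of_all _ hf
  simpa using norm_integral_le_of_norm_le_const h

lemma abs_deviation_le {Z : Type*} [MeasurableSpace Z] (ρ : Measure Z) [IsProbabilityMeasure ρ]
    {f : Z → ℝ} (hB : 0 ≤ B) (hf : ∀ z, |f z| ≤ B) (x : Fin n → Z) :
    |∫ z, f z ∂ρ - (1 / n : ℝ) * ∑ i, f (x i)| ≤ 2 * B := by
  have h1 := abs_le.1 (abs_integral_le_of_abs_le ρ hf)
  have h2 := abs_le.1 (abs_mean_le hB fun i => hf (x i))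
  exact abs_le.2 ⟨by linarith [h1.1, h2.2], by linarith [h1.2, h2.1]⟩

variable (ρ : Measure Z) [IsProbabilityMeasure ρ] {d : ι → Z → ℝ}

/-- Replacing one of the `n` points changes the uniform deviation by at most `2 * B / n`. -/
lemma abs_uniformDeviation_update_sub_le {ι Z : Type*} [Nonempty ι] [MeasurableSpace Z] {n : ℕ}
    (ρ : Measure Z) [IsProbabilityMeasure ρ] {d : ι → Z → ℝ} (hB : 0 ≤ B) (hb : ∀ t z, |d t z| ≤ B)
    (x : Fin n → Z) (i : Fin n) (z : Z) :
    |uniformDeviation ρ d (Function.update x i z) - uniformDeviation ρ d x| ≤ 2 * B / n := by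
  have hn : (0 : ℝ) < n := by exact_mod_cast i.pos
  have hbdd : ∀ y : Fin n → Z, BddAbove (Set.range fun t =>
      ∫ z, d t z ∂ρ - (1 / n : ℝ) * ∑ i, d t (y i)) := fun y =>
    bddAbove_range_of_abs_le fun t => abs_deviation_le ρ hB (hb t) y
  have hsum : ∀ t, |(1 / n : ℝ) * ∑ j, d t (Function.update x i z j)
      - (1 / n : ℝ) * ∑ j, d t (x j)| ≤ 2 * B / n := by
    intro t
    have : ∑ j, d t (Function.update x i z j) - ∑ j, d t (x j) = d t z - d t (x i) := by
      rw [← Finset.sum_sub_distrib, Finset.sum_eq_single i]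
      · rw [Function.update_self]
      · intro j _ hj
        rw [Function.update_of_ne hj, sub_self]
      · simp
    rw [← mul_sub, this, abs_mul, abs_of_nonneg (by positivity : (0 : ℝ) ≤ 1 / n), div_mul_eq_mul_div,
      one_mul]
    refine div_le_div_of_nonneg_right ?_ hn.le
    have h1 := abs_le.1 (hb t z)
    have h2 := abs_le.1 (hb t (x i))
    exact abs_le.2 ⟨by linarith [h1.1, h2.2], by linarith [h1.2, h2.1]⟩
  rw [abs_sub_le_iff]
  constructor
  · rw [sub_le_iff_le_add]
    refine ciSup_le fun t => ?_
    have := le_ciSup (hbdd x) t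
    have := (abs_le.1 (hsum t)).1
    simp only [uniformDeviation] at *
    linarith
  · rw [sub_le_iff_le_add]
    refine ciSup_le fun t => ?_
    have := le_ciSup (hbdd (Function.update x i z)) t
    have := (abs_le.1 (hsum t)).2
    simp only [uniformDeviation] at *
    linarith

lemma integral_eq_integral_eval {f : Z → ℝ} (hf : Measurable f) (i : Fin n) :
    ∫ x : Fin n → Z, f (x i) ∂(Measure.pi fun _ => ρ) = ∫ z, f z ∂ρ := by
  have h := measurePreserving_eval (fun _ : Fin n => ρ) i
  exact (integral_map h.measurable.aemeasurable
    (by rw [h.map_eq]; exact hf.aestronglyMeasurable)).symm.trans (by rw [h.map_eq])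

lemma integral_mean_eq (hn : 0 < n) {f : Z → ℝ} (hf : Measurable f) (hb : ∀ z, |f z| ≤ B) :
    ∫ x : Fin n → Z, (1 / n : ℝ) * ∑ i, f (x i) ∂(Measure.pi fun _ => ρ) = ∫ z, f z ∂ρ := by
  rw [integral_const_mul, integral_finsetSum]
  · simp_rw [integral_eq_integral_eval ρ hf]
    have : (n : ℝ) ≠ 0 := by exact_mod_cast hn.ne'
    simp [this]
  · exact fun i _ => Integrable.of_bound
      (hf.comp (measurable_pi_apply i)).aestronglyMeasurable B (ae_of_all _ fun x => hb _)

/-- The supremum over the family of the signed difference of the empirical means of two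
samples. -/
noncomputable def signedGap {ι Z : Type*} {n : ℕ} (d : ι → Z → ℝ) (σ : Fin n → ℤˣ)
    (a : Fin n → Z × Z) : ℝ :=
  ⨆ t, (1 / n : ℝ) * ∑ i, ((σ i : ℤ) : ℝ) * (d t (a i).1 - d t (a i).2)

lemma measurable_signedGap {ι Z : Type*} [Countable ι] [MeasurableSpace Z] {n : ℕ} {d : ι → Z → ℝ}
    (hd : ∀ t, Measurable (d t)) (σ : Fin n → ℤˣ) : Measurable (signedGap d σ) :=
  Measurable.iSup fun t => (Finset.measurable_fun_sum _ fun i _ =>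
    (((hd t).comp (measurable_fst.comp (measurable_pi_apply i))).sub
      ((hd t).comp (measurable_snd.comp (measurable_pi_apply i)))).const_mul _).const_mul _

lemma abs_sub_le_two_mul {a b : ℝ} (ha : |a| ≤ B) (hb : |b| ≤ B) : |a - b| ≤ 2 * B := by
  refine (abs_sub _ _).trans ?_
  linarith

lemma integrable_signedGap (hB : 0 ≤ B) (hd : ∀ t, Measurable (d t)) (hb : ∀ t z, |d t z| ≤ B)
    (σ : Fin n → ℤˣ) : Integrable (signedGap d σ) (Measure.pi fun _ => ρ.prod ρ) :=
  Integrable.of_bound (measurable_signedGap hd σ).aestronglyMeasurable (2 * B)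
    (ae_of_all _ fun a => abs_iSup_le fun t => abs_sign_mean_le (by positivity)
      (fun i => abs_sub_le_two_mul (hb t _) (hb t _)) σ)

/-- Swapping the two copies of the points with sign `-1` does not change the law. -/
lemma integral_signedGap_eq {ι Z : Type*} [Countable ι] [MeasurableSpace Z] {n : ℕ}
    (ρ : Measure Z) [IsProbabilityMeasure ρ] {d : ι → Z → ℝ} (hd : ∀ t, Measurable (d t)) (σ : Fin n → ℤˣ) :
    ∫ a, signedGap d σ a ∂(Measure.pi fun _ => ρ.prod ρ)
      = ∫ a, signedGap d (1 : Fin n → ℤˣ) a ∂(Measure.pi fun _ => ρ.prod ρ) := by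
  have hψ : MeasurePreserving
      (fun (a : Fin n → Z × Z) i => (if σ i = 1 then id else Prod.swap) (a i))
      (Measure.pi fun _ => ρ.prod ρ) (Measure.pi fun _ => ρ.prod ρ) := by
    refine measurePreserving_pi _ _ fun i => ?_
    split_ifs
    · exact MeasurePreserving.id _
    · exact Measure.measurePreserving_swap
  nth_rewrite 2 [← hψ.map_eq]
  rw [integral_map hψ.measurable.aemeasurable (measurable_signedGap hd 1).aestronglyMeasurable]
  refine integral_congr_ae (ae_of_all _ fun a => ?_)
  refine iSup_congr fun t => congrArg _ (Finset.sum_congr rfl fun i _ => ?_)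
  rcases Int.units_eq_one_or (σ i) with h | h <;> simp [h]

/-- **Symmetrization**: the expected uniform deviation is at most twice the Rademacher
complexity. -/
theorem integral_uniformDeviation_le (hn : 0 < n) (hB : 0 ≤ B) (hd : ∀ t, Measurable (d t))
    (hb : ∀ t z, |d t z| ≤ B) :
    ∫ x : Fin n → Z, uniformDeviation ρ d x ∂(Measure.pi fun _ => ρ)
      ≤ 2 * ∫ x : Fin n → Z, signAverage (fun t i => d t (x i)) ∂(Measure.pi fun _ => ρ) := by
  set π : Measure (Fin n → Z) := Measure.pi fun _ => ρ
  set e := MeasurableEquiv.arrowProdEquivProdArrow Z Z (Fin n)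
  have hpe : MeasurePreserving e (Measure.pi fun _ => ρ.prod ρ) (π.prod π) :=
    measurePreserving_arrowProdEquivProdArrow Z Z (Fin n) (fun _ => ρ) (fun _ => ρ)
  have hesymm : ∀ p i, e.symm p i = (p.1 i, p.2 i) := fun p i => rfl
  have hgap : Integrable (fun p => signedGap d (1 : Fin n → ℤˣ) (e.symm p)) (π.prod π) := by
    have := integrable_signedGap ρ hB hd hb (1 : Fin n → ℤˣ)
    exact (hpe.symm.integrable_comp_emb e.symm.measurableEmbedding).2 this
  have hmean : ∀ t, Integrable (fun x : Fin n → Z => (1 / n : ℝ) * ∑ i, d t (x i)) π := fun t =>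
    Integrable.of_bound ((Finset.measurable_fun_sum _ fun i _ =>
      (hd t).comp (measurable_pi_apply i)).const_mul _).aestronglyMeasurable B
      (ae_of_all _ fun x => abs_mean_le hB fun i => hb t (x i))
  have hgb : ∀ (σ : Fin n → ℤˣ) (a : Fin n → Z × Z), BddAbove (Set.range fun t =>
      (1 / n : ℝ) * ∑ i, ((σ i : ℤ) : ℝ) * (d t (a i).1 - d t (a i).2)) := fun σ a =>
    bddAbove_range_of_abs_le fun t => abs_sign_mean_le (B := 2 * B) (by positivity)
      (fun i => abs_sub_le_two_mul (hb t _) (hb t _)) σ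
  -- Ghost sample: the true mean is the expected empirical mean of an independent copy `x`, and a
  -- supremum of expectations is at most the expectation of the supremum. Fubini gives integrability
  -- of the sections only for almost every `y`.
  have h1 : ∀ᵐ y ∂π, uniformDeviation ρ d y ≤ ∫ x, signedGap d (1 : Fin n → ℤˣ) (e.symm (x, y)) ∂π := by
    filter_upwards [hgap.prod_left_ae] with y hy
    refine ciSup_le fun t => ?_
    rw [← integral_mean_eq ρ hn (hd t) (hb t)]
    have : ∫ x : Fin n → Z, (1 / n : ℝ) * ∑ i, d t (x i) ∂π - (1 / n : ℝ) * ∑ i, d t (y i)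
        = ∫ x : Fin n → Z, ((1 / n : ℝ) * ∑ i, d t (x i) - (1 / n : ℝ) * ∑ i, d t (y i)) ∂π := by
      rw [integral_sub (hmean t) (integrable_const _)]
      simp
    rw [this]
    refine integral_mono ((hmean t).sub (integrable_const _)) hy fun x => ?_
    refine le_trans (le_of_eq ?_) (le_ciSup (hgb 1 (e.symm (x, y))) t)
    simp [hesymm, mul_sub]
  have h2 : ∫ y, uniformDeviation ρ d y ∂π ≤ ∫ a, signedGap d (1 : Fin n → ℤˣ) a ∂(Measure.pi fun _ => ρ.prod ρ) := by
    have hU : Integrable (uniformDeviation ρ d) π :=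
      Integrable.of_bound (measurable_uniformDeviation ρ hd).aestronglyMeasurable (2 * B)
        (ae_of_all _ fun x => abs_iSup_le fun t => abs_deviation_le ρ hB (hb t) x)
    refine (integral_mono_ae hU hgap.integral_prod_right h1).trans (le_of_eq ?_)
    rw [← integral_prod_symm _ hgap]
    exact hpe.symm.integral_comp' (signedGap d (1 : Fin n → ℤˣ))
  have hsa : ∀ {f : Z × Z → Z}, MeasurePreserving f (ρ.prod ρ) ρ →
      Integrable (fun a : Fin n → Z × Z => signAverage fun t i => d t (f (a i)))
          (Measure.pi fun _ => ρ.prod ρ) ∧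
        ∫ a : Fin n → Z × Z, signAverage (fun t i => d t (f (a i))) ∂(Measure.pi fun _ => ρ.prod ρ)
          = ∫ x, signAverage (fun t i => d t (x i)) ∂π := by
    intro f hf
    have hp : MeasurePreserving (fun (a : Fin n → Z × Z) i => f (a i))
        (Measure.pi fun _ => ρ.prod ρ) π := measurePreserving_pi _ _ fun _ => hf
    refine ⟨integrable_signAverage _ hB
      (fun t i => (hd t).comp (hf.measurable.comp (measurable_pi_apply i)))
      (fun a t i => hb t _), ?_⟩
    rw [← hp.map_eq, integral_map hp.measurable.aemeasurable]
    exact (measurable_signAverage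
      fun t i => (hd t).comp (measurable_pi_apply i)).aestronglyMeasurable
  obtain ⟨hi1, hv1⟩ := hsa measurePreserving_fst
  obtain ⟨hi2, hv2⟩ := hsa measurePreserving_snd
  -- Every sign vector gives the same integral, so the integral for σ = 1 equals its average over σ,
  -- which is a sign average.
  have h3 : ∫ a, signedGap d (1 : Fin n → ℤˣ) a ∂(Measure.pi fun _ => ρ.prod ρ)
      = ∫ a : Fin n → Z × Z, signAverage (fun t i => d t (a i).1 - d t (a i).2)
          ∂(Measure.pi fun _ => ρ.prod ρ) := by
    change _ = ∫ a, (1 / 2 ^ n : ℝ) * ∑ σ, signedGap d σ a ∂_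
    rw [integral_const_mul, integral_finsetSum _ fun σ _ => integrable_signedGap ρ hB hd hb σ]
    simp_rw [integral_signedGap_eq ρ hd]
    simp
  rw [h3] at h2
  refine h2.trans ?_
  rw [two_mul]
  nth_rewrite 1 [← hv1]
  rw [← hv2, ← integral_add hi1 hi2]
  refine integral_mono (integrable_signAverage _ (B := 2 * B) (by positivity) (fun t i =>
    ((hd t).comp (measurable_fst.comp (measurable_pi_apply i))).sub
      ((hd t).comp (measurable_snd.comp (measurable_pi_apply i))))
    (fun a t i => abs_sub_le_two_mul (hb t _) (hb t _))) (hi1.add hi2) fun a => ?_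
  -- The two samples are separated by subadditivity; each contributes one Rademacher complexity,
  -- whence the factor 2.
  have h4 := signAverage_add_le hB (u := fun t i => d t (a i).1) (v := fun t i => -d t (a i).2)
    (fun t i => hb t _) (fun t i => by rw [abs_neg]; exact hb t _)
  have h5 := signAverage_neg_le (u := fun t i => d t (a i).2) (fun t i => hb t _)
  simp only [← sub_eq_add_neg] at h4
  linarith

end Symmetrization

/-! ### Reduction to countable subclasses. -/

/-- `F₀` is a subclass of `F` from which each member of `F` is a pointwise limit of a sequence. -/
def IsPointwiseDense {X : Type*} (F₀ F : Set (X → ℝ)) : Prop :=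
  F₀ ⊆ F ∧ ∀ f ∈ F, ∃ u : ℕ → X → ℝ,
    (∀ k, u k ∈ F₀) ∧ ∀ x, Tendsto (fun k => u k x) atTop (𝓝 (f x))

section Classes

variable {X : Type*} {F F₀ : Set (X → ℝ)} {B : ℝ}

lemma IsPointwiseDense.nonempty (h : IsPointwiseDense F₀ F) (hF : F.Nonempty) : F₀.Nonempty := by
  obtain ⟨f, hf⟩ := hF
  obtain ⟨u, hu, -⟩ := h.2 f hf
  exact ⟨u 0, hu 0⟩

/-- Only finitely many evaluations occur for each sign vector, so pointwise limits do not raise the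
supremum. This lets measure theory be done on the countable class while the final bound mentions the
full one. -/
lemma IsPointwiseDense.empiricalRademacher_eq {n : ℕ} (h : IsPointwiseDense F₀ F)
    (hF : F.Nonempty) (hB : 0 ≤ B) (hb : ∀ f ∈ F, ∀ x, |f x| ≤ B) (x : Fin n → X) :
    empiricalRademacher F x = empiricalRademacher F₀ x := by
  have hne : Nonempty F₀ := (h.nonempty hF).to_subtype
  have hne' : Nonempty F := hF.to_subtype
  refine congrArg _ (Finset.sum_congr rfl fun σ _ => le_antisymm (ciSup_le fun f => ?_) ?_)
  · obtain ⟨u, hu, hlim⟩ := h.2 f.1 f.2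
    refine le_of_tendsto' (x := atTop) ((tendsto_finsetSum _ fun i _ =>
      (hlim (x i)).const_mul ((σ i : ℤ) : ℝ)).const_mul (1 / n : ℝ)) fun k => ?_
    exact le_ciSup (bddAbove_sign_mean (u := fun (f : F₀) i => f.1 (x i)) hB
      (fun f i => hb _ (h.1 f.2) _) σ) ⟨u k, hu k⟩
  · exact ciSup_le fun f => le_ciSup (bddAbove_sign_mean (u := fun (f : F) i => f.1 (x i)) hB
      (fun f i => hb _ f.2 _) σ) ⟨f.1, h.1 f.2⟩

lemma IsPointwiseDense.rademacher_eq [MeasurableSpace X] (h : IsPointwiseDense F₀ F)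
    (hF : F.Nonempty) (hB : 0 ≤ B) (hb : ∀ f ∈ F, ∀ x, |f x| ≤ B) (n : ℕ) (ρ : Measure X) :
    rademacher n ρ F = rademacher n ρ F₀ := by
  simp only [rademacher, h.empiricalRademacher_eq hF hB hb]

lemma empiricalRademacher_nonneg {n : ℕ} (hF : F.Nonempty) (hb : ∀ f ∈ F, ∀ x, |f x| ≤ B)
    (x : Fin n → X) : 0 ≤ empiricalRademacher F x := by
  have : Nonempty F := hF.to_subtype
  exact signAverage_nonneg (B := B) fun f i => hb _ f.2 _

lemma rademacher_nonneg [MeasurableSpace X] (hF : F.Nonempty) (hb : ∀ f ∈ F, ∀ x, |f x| ≤ B)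
    (n : ℕ) (ρ : Measure X) : 0 ≤ rademacher n ρ F :=
  integral_nonneg fun x => empiricalRademacher_nonneg hF hb x

lemma integrable_empiricalRademacher_comp [MeasurableSpace X] {Z : Type*} [MeasurableSpace Z]
    {n : ℕ} (hc : F.Countable) (hF : F.Nonempty) (hB : 0 ≤ B) (hm : ∀ f ∈ F, Measurable f)
    (hb : ∀ f ∈ F, ∀ x, |f x| ≤ B) (P : Measure (Fin n → Z)) [IsFiniteMeasure P] {g : Z → X}
    (hg : Measurable g) : Integrable (fun x => empiricalRademacher F fun i => g (x i)) P := by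
  have : Nonempty F := hF.to_subtype
  have : Countable F := hc.to_subtype
  exact integrable_signAverage P hB
    (fun f i => (hm _ f.2).comp (hg.comp (measurable_pi_apply i))) (fun x f i => hb _ f.2 _)

lemma integral_empiricalRademacher_comp [MeasurableSpace X] {Z : Type*} [MeasurableSpace Z]
    {n : ℕ} (hc : F.Countable) (hm : ∀ f ∈ F, Measurable f) {P : Measure Z} {ρ : Measure X}
    [SigmaFinite ρ] {g : Z → X} (hg : MeasurePreserving g P ρ) :
    ∫ x : Fin n → Z, empiricalRademacher F (fun i => g (x i)) ∂(Measure.pi fun _ => P)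
      = rademacher n ρ F := by
  have : Countable F := hc.to_subtype
  have hp : MeasurePreserving (fun (x : Fin n → Z) i => g (x i)) (Measure.pi fun _ => P)
      (Measure.pi fun _ => ρ) := measurePreserving_pi _ _ fun _ => hg
  rw [rademacher, ← hp.map_eq, integral_map hp.measurable.aemeasurable]
  exact (measurable_signAverage
    fun (f : F) i => (hm _ f.2).comp (measurable_pi_apply i)).aestronglyMeasurable

end Classes

/-! ### Greedy values: bounds, measurability, pointwise limits. -/

section GreedyValue

variable {S A : Type*} [Fintype A] [Nonempty A] {B : ℝ} {q : S × A → ℝ}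

lemma abs_greedyValue_le (hq : ∀ x, |q x| ≤ B) (s : S) : |greedyValue q s| ≤ B := by
  obtain ⟨a, -, ha⟩ := Finset.exists_mem_eq_sup' Finset.univ_nonempty fun a : A => q (s, a)
  rw [greedyValue, ha]
  exact hq _

lemma measurable_greedyValue [MeasurableSpace S] [MeasurableSpace A] (hq : Measurable q) :
    Measurable (greedyValue q) := by
  have h := Finset.measurable_sup' (Finset.univ_nonempty (α := A))
    (f := fun a (s : S) => q (s, a)) fun a _ => hq.comp measurable_prodMk_right
  convert h using 1
  funext s
  rw [Finset.sup'_apply]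
  rfl

lemma tendsto_greedyValue {u : ℕ → S × A → ℝ}
    (h : ∀ x, Tendsto (fun k => u k x) atTop (𝓝 (q x))) (s : S) :
    Tendsto (fun k => greedyValue (u k) s) atTop (𝓝 (greedyValue q s)) :=
  Tendsto.finset_sup'_nhds_apply Finset.univ_nonempty fun a _ => h (s, a)

lemma IsPointwiseDense.greedyValueClass {F₀ F : Set (S × A → ℝ)} (h : IsPointwiseDense F₀ F) :
    IsPointwiseDense (greedyValueClass F₀) (greedyValueClass F) := by
  refine ⟨Set.image_mono h.1, ?_⟩
  rintro _ ⟨q, hq, rfl⟩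
  obtain ⟨u, hu, hlim⟩ := h.2 q hq
  exact ⟨fun k => greedyValue (u k), fun k => ⟨u k, hu k, rfl⟩, tendsto_greedyValue hlim⟩

end GreedyValue

/-! ### Size and mean of the loss gap. -/

namespace EpisodicMDP

variable {S A : Type*} [MeasurableSpace S] [MeasurableSpace A] [Fintype A] [Nonempty A] {H : ℕ}
  (M : EpisodicMDP S A H) (h : Fin H)

/-- The difference of the squared losses of `f` and of `g` with the regression target of `q`. -/
noncomputable def lossGap (f g q : S × A → ℝ) (z : (S × A) × S) : ℝ :=
  M.sqLoss h f q z - M.sqLoss h g q z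

section Bounded

variable {f g q : S × A → ℝ} (hf : ∀ x, |f x| ≤ H) (hg : ∀ x, |g x| ≤ H) (hq : ∀ x, |q x| ≤ H)

lemma one_le_horizon {H : ℕ} (h : Fin H) : (1 : ℝ) ≤ H := by exact_mod_cast h.pos

include hf hq in
lemma abs_residual_le (z : (S × A) × S) :
    |f z.1 - M.reward h z.1 - greedyValue q z.2| ≤ 3 * H := by
  have h1 := abs_le.1 (hf z.1)
  have h2 := M.reward_mem h z.1
  have h3 := abs_le.1 (abs_greedyValue_le hq z.2)
  -- The existence of a step forces H ≥ 1, so the reward bound 1 is absorbed: H + 1 + H ≤ 3H.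
  have h4 := one_le_horizon h
  exact abs_le.2 ⟨by linarith [h1.1, h2.2, h3.2], by linarith [h1.2, h2.1, h3.1]⟩

include hf hq in
lemma sqLoss_mem_Icc (z : (S × A) × S) : M.sqLoss h f q z ∈ Set.Icc 0 (9 * (H : ℝ) ^ 2) := by
  refine ⟨sq_nonneg _, ?_⟩
  have := sq_le_sq' (abs_le.1 (M.abs_residual_le h hf hq z)).1
    (abs_le.1 (M.abs_residual_le h hf hq z)).2
  rw [sqLoss]
  linarith

include hf hg hq in
lemma abs_lossGap_le (z : (S × A) × S) : |M.lossGap h f g q z| ≤ 9 * (H : ℝ) ^ 2 := by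
  -- Both losses lie in [0, 9H²], so their difference does not double the bound.
  have h1 := M.sqLoss_mem_Icc h hf hq z
  have h2 := M.sqLoss_mem_Icc h hg hq z
  exact abs_le.2 ⟨by rw [lossGap]; linarith [h1.1, h2.2], by rw [lossGap]; linarith [h1.2, h2.1]⟩

end Bounded

end EpisodicMDP

namespace EpisodicMDP

variable {S A : Type*} [MeasurableSpace S] [MeasurableSpace A] [Fintype A] [Nonempty A] {H : ℕ}
  (M : EpisodicMDP S A H) (h : Fin H)

lemma measurable_sqLoss {f q : S × A → ℝ} (hf : Measurable f) (hq : Measurable q) :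
    Measurable (M.sqLoss h f q) :=
  (((hf.comp measurable_fst).sub ((M.measurable_reward h).comp measurable_fst)).sub
    ((measurable_greedyValue hq).comp measurable_snd)).pow_const 2

lemma measurable_lossGap {f g q : S × A → ℝ} (hf : Measurable f) (hg : Measurable g)
    (hq : Measurable q) : Measurable (M.lossGap h f g q) :=
  (M.measurable_sqLoss h hf hq).sub (M.measurable_sqLoss h hg hq)

lemma measurable_bellman {q : S × A → ℝ} (hq : Measurable q) : Measurable (M.bellman h q) := by
  have := M.markov_transition h
  exact (M.measurable_reward h).add
    ((measurable_greedyValue hq).comp measurable_snd).stronglyMeasurable.integral_kernel_prod_right'.measurable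

lemma abs_bellman_le {q : S × A → ℝ} (hq : ∀ x, |q x| ≤ H) (x : S × A) :
    |M.bellman h q x| ≤ 2 * H := by
  have := M.markov_transition h
  have h1 := M.reward_mem h x
  have h2 := abs_le.1 (abs_integral_le_of_abs_le (M.transition h x) (abs_greedyValue_le hq))
  have h3 := one_le_horizon h
  exact abs_le.2 ⟨by rw [bellman]; linarith [h1.1, h2.1], by rw [bellman]; linarith [h1.2, h2.2]⟩

lemma integrable_sq_sub_bellman (μ : Measure (S × A)) [IsProbabilityMeasure μ] {f q : S × A → ℝ}
    (hfm : Measurable f) (hqm : Measurable q) (hf : ∀ x, |f x| ≤ H) (hq : ∀ x, |q x| ≤ H) :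
    Integrable (fun x => (f x - M.bellman h q x) ^ 2) μ := by
  refine Integrable.of_bound
    ((hfm.sub (M.measurable_bellman h hqm)).pow_const 2).aestronglyMeasurable
    ((3 * H) ^ 2) (ae_of_all _ fun x => ?_)
  rw [Real.norm_eq_abs, abs_pow]
  refine pow_le_pow_left₀ (abs_nonneg _) ((abs_sub _ _).trans ?_) 2
  linarith [hf x, M.abs_bellman_le h hq x]

/-- The variance of the regression target cancels in the mean of the loss gap. -/
lemma integral_lossGap (μ : Fin H → Measure (S × A)) [IsProbabilityMeasure (μ h)]
    {f g q : S × A → ℝ} (hfm : Measurable f) (hgm : Measurable g) (hqm : Measurable q)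
    (hf : ∀ x, |f x| ≤ H) (hg : ∀ x, |g x| ≤ H) (hq : ∀ x, |q x| ≤ H) :
    ∫ z, M.lossGap h f g q z ∂(M.sampleLaw μ h)
      = ∫ x, (f x - M.bellman h q x) ^ 2 ∂(μ h) - ∫ x, (g x - M.bellman h q x) ^ 2 ∂(μ h) := by
  have := M.markov_transition h
  have hint : Integrable (M.lossGap h f g q) (μ h ⊗ₘ M.transition h) :=
    Integrable.of_bound (M.measurable_lossGap h hfm hgm hqm).aestronglyMeasurable _
      (ae_of_all _ (M.abs_lossGap_le h hf hg hq))
  rw [sampleLaw, Measure.integral_compProd hint,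
    ← integral_sub (M.integrable_sq_sub_bellman h (μ h) hfm hqm hf hq)
      (M.integrable_sq_sub_bellman h (μ h) hgm hqm hg hq)]
  refine integral_congr_ae (ae_of_all _ fun x => ?_)
  have hV : Integrable (greedyValue q) (M.transition h x) :=
    Integrable.of_bound (measurable_greedyValue hqm).aestronglyMeasurable _
      (ae_of_all _ (abs_greedyValue_le hq))
  -- A difference of squares with a common target is affine in that target; only the conditional
  -- mean of V survives integration.
  have hexp : ∀ s, M.lossGap h f g q (x, s)
      = (f x - g x) * (f x + g x - 2 * M.reward h x) - 2 * (f x - g x) * greedyValue q s := by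
    intro s
    simp only [lossGap, sqLoss]
    ring
  simp only [hexp]
  rw [integral_sub (integrable_const _) (hV.const_mul _),
    integral_const_mul (2 * (f x - g x)) (greedyValue q)]
  simp only [bellman, integral_const, probReal_univ, one_smul]
  ring

/-! ### Uniform concentration at one step. -/

section OneStep

variable (μ : Fin H → Measure (S × A)) {n : ℕ}

instance isProbabilityMeasure_sampleLaw [IsProbabilityMeasure (μ h)] :
    IsProbabilityMeasure (M.sampleLaw μ h) := by
  have := M.markov_transition h
  unfold sampleLaw
  infer_instance

instance isProbabilityMeasure_nextStateLaw [IsProbabilityMeasure (μ h)] :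
    IsProbabilityMeasure (M.nextStateLaw μ h) := by
  unfold nextStateLaw
  infer_instance

lemma measurePreserving_fst_sampleLaw {S A : Type*} [MeasurableSpace S] [MeasurableSpace A] {H : ℕ}
    (M : EpisodicMDP S A H) (h : Fin H) (μ : Fin H → Measure (S × A)) [IsProbabilityMeasure (μ h)] :
    MeasurePreserving Prod.fst (M.sampleLaw μ h) (μ h) := by
  have := M.markov_transition h
  exact ⟨measurable_fst, Measure.fst_compProd (μ h) (M.transition h)⟩

lemma measurePreserving_snd_sampleLaw {S A : Type*} [MeasurableSpace S] [MeasurableSpace A] {H : ℕ}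
    (M : EpisodicMDP S A H) (h : Fin H) (μ : Fin H → Measure (S × A)) :
    MeasurePreserving Prod.snd (M.sampleLaw μ h) (M.nextStateLaw μ h) :=
  ⟨measurable_snd, rfl⟩

/-- The signed average of the squared losses is controlled by the Rademacher complexities of the
two classes. -/
lemma signAverage_sqLoss_le {ι : Type*} [Nonempty ι] {K Q : Set (S × A → ℝ)}
    (hK : ∀ f ∈ K, ∀ x, |f x| ≤ H) (hQ : ∀ q ∈ Q, ∀ x, |q x| ≤ H) (f : ι → K) (q : ι → Q)
    (x : Fin n → (S × A) × S) :
    signAverage (fun t i => M.sqLoss h (f t).1 (q t).1 (x i))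
      ≤ 6 * H * (empiricalRademacher K (fun i => (x i).1)
          + empiricalRademacher (greedyValueClass Q) (fun i => (x i).2)) := by
  have hH := one_le_horizon h
  have hH0 : (0 : ℝ) ≤ H := by linarith
  have hV : ∀ t i, |greedyValue (q t).1 (x i).2| ≤ H := fun t i =>
    abs_greedyValue_le (hQ _ (q t).2) _
  have hfb : ∀ t i, |(f t).1 (x i).1| ≤ H := fun t i => hK _ (f t).2 _
  have hVneg : ∀ t i, |-greedyValue (q t).1 (x i).2| ≤ H := fun t i => by
    rw [abs_neg]; exact hV t i
  have hd : ∀ t i, |6 * (H : ℝ) * ((f t).1 (x i).1 + -greedyValue (q t).1 (x i).2)|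
      ≤ 12 * (H : ℝ) ^ 2 := by
    intro t i
    rw [abs_mul, abs_of_nonneg (by positivity : (0 : ℝ) ≤ 6 * H)]
    have := (abs_add_le _ _).trans (add_le_add (hfb t i) (hVneg t i))
    nlinarith
  have h1 : signAverage (fun t i => M.sqLoss h (f t).1 (q t).1 (x i))
      ≤ signAverage fun t i => 6 * (H : ℝ) * ((f t).1 (x i).1 + -greedyValue (q t).1 (x i).2) := by
    refine signAverage_le_of_contraction (B := 12 * (H : ℝ) ^ 2) _ _ (fun t i => ?_) hd
      fun t s i => ?_
    · have := M.sqLoss_mem_Icc h (hK _ (f t).2) (hQ _ (q t).2) (x i)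
      rw [abs_of_nonneg this.1]
      nlinarith [this.2]
    · have ht := abs_le.1 (M.abs_residual_le h (hK _ (f t).2) (hQ _ (q t).2) (x i))
      have hs := abs_le.1 (M.abs_residual_le h (hK _ (f s).2) (hQ _ (q s).2) (x i))
      set a := (f t).1 (x i).1 - M.reward h (x i).1 - greedyValue (q t).1 (x i).2 with ha
      set b := (f s).1 (x i).1 - M.reward h (x i).1 - greedyValue (q s).1 (x i).2 with hb
      -- a² − b² = (a + b)(a − b) with residuals of size at most 3H gives the Lipschitz constant 6H;
      -- the reward depends only on the data point and cancels in a − b.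
      have e1 : M.sqLoss h (f t).1 (q t).1 (x i) - M.sqLoss h (f s).1 (q s).1 (x i)
          = (a + b) * (a - b) := by
        simp only [sqLoss, ha, hb]
        ring
      have e2 : 6 * (H : ℝ) * ((f t).1 (x i).1 + -greedyValue (q t).1 (x i).2)
          - 6 * (H : ℝ) * ((f s).1 (x i).1 + -greedyValue (q s).1 (x i).2)
          = 6 * H * (a - b) := by
        simp only [ha, hb]
        ring
      rw [e1, e2, abs_mul, abs_mul, abs_of_nonneg (by positivity : (0 : ℝ) ≤ 6 * H)]
      refine mul_le_mul_of_nonneg_right ?_ (abs_nonneg _)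
      exact abs_le.2 ⟨by linarith [ht.1, hs.1], by linarith [ht.2, hs.2]⟩
  refine h1.trans ?_
  rw [signAverage_const_mul (by positivity)]
  refine mul_le_mul_of_nonneg_left ?_ (by positivity)
  refine (signAverage_add_le hH0 hfb hVneg).trans (add_le_add ?_ ?_)
  · exact signAverage_comp_le (u := fun (k : K) i => k.1 (x i).1) hH0
      (fun k i => hK _ k.2 _) f
  · refine (signAverage_neg_le hV).trans ?_
    refine signAverage_comp_le (u := fun (v : greedyValueClass Q) i => v.1 (x i).2) hH0
      (fun v i => ?_) (fun t => (⟨greedyValue (q t).1, (q t).1, (q t).2, rfl⟩ : greedyValueClass Q))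
    obtain ⟨_, q, hq, rfl⟩ := v
    exact abs_greedyValue_le (hQ _ hq) _

/-- Differences of loss gaps, indexed by pairs of triples `(f, g, q)` from three classes. -/
noncomputable def pairGap {K L Q : Set (S × A → ℝ)} (p : (K × L × Q) × (K × L × Q))
    (z : (S × A) × S) : ℝ :=
  M.lossGap h p.1.1.1 p.1.2.1.1 p.1.2.2.1 z - M.lossGap h p.2.1.1 p.2.2.1.1 p.2.2.2.1 z

section Pair

variable {K L Q : Set (S × A → ℝ)}

lemma abs_pairGap_le (hK : ∀ f ∈ K, ∀ x, |f x| ≤ H) (hL : ∀ g ∈ L, ∀ x, |g x| ≤ H)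
    (hQ : ∀ q ∈ Q, ∀ x, |q x| ≤ H) (p : (K × L × Q) × (K × L × Q)) (z : (S × A) × S) :
    |M.pairGap h p z| ≤ 18 * (H : ℝ) ^ 2 := by
  have h1 := M.abs_lossGap_le h (hK _ p.1.1.2) (hL _ p.1.2.1.2) (hQ _ p.1.2.2.2) z
  have h2 := M.abs_lossGap_le h (hK _ p.2.1.2) (hL _ p.2.2.1.2) (hQ _ p.2.2.2.2) z
  refine (abs_sub _ _).trans ?_
  linarith

lemma measurable_pairGap (hK : ∀ f ∈ K, Measurable f) (hL : ∀ g ∈ L, Measurable g)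
    (hQ : ∀ q ∈ Q, Measurable q) (p : (K × L × Q) × (K × L × Q)) : Measurable (M.pairGap h p) :=
  (M.measurable_lossGap h (hK _ p.1.1.2) (hL _ p.1.2.1.2) (hQ _ p.1.2.2.2)).sub
    (M.measurable_lossGap h (hK _ p.2.1.2) (hL _ p.2.2.1.2) (hQ _ p.2.2.2.2))

/-- A pair consists of two gaps and a gap of two losses, each loss costing 6H: hence 12H. The greedy
values occur in both losses of a gap, hence the extra 2. -/
lemma signAverage_pairGap_le (hK0 : K.Nonempty) (hL0 : L.Nonempty) (hQ0 : Q.Nonempty)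
    (hK : ∀ f ∈ K, ∀ x, |f x| ≤ H) (hL : ∀ g ∈ L, ∀ x, |g x| ≤ H)
    (hQ : ∀ q ∈ Q, ∀ x, |q x| ≤ H) (x : Fin n → (S × A) × S) :
    signAverage (fun (p : (K × L × Q) × (K × L × Q)) i => M.pairGap h p (x i))
      ≤ 12 * H * (empiricalRademacher K (fun i => (x i).1)
          + empiricalRademacher L (fun i => (x i).1)
          + 2 * empiricalRademacher (greedyValueClass Q) (fun i => (x i).2)) := by
  have := hK0.to_subtype
  have := hL0.to_subtype
  have := hQ0.to_subtype
  have hB : (0 : ℝ) ≤ 9 * (H : ℝ) ^ 2 := by positivity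
  have hloss : ∀ {K' : Set (S × A → ℝ)}, (∀ f ∈ K', ∀ x, |f x| ≤ H) →
      ∀ (f : K') (q : Q) z, |M.sqLoss h f.1 q.1 z| ≤ 9 * (H : ℝ) ^ 2 := by
    intro K' hK' f q z
    have := M.sqLoss_mem_Icc h (hK' _ f.2) (hQ _ q.2) z
    rw [abs_of_nonneg this.1]
    exact this.2
  have hgap : ∀ (t : K × L × Q) z, |M.lossGap h t.1.1 t.2.1.1 t.2.2.1 z| ≤ 9 * (H : ℝ) ^ 2 :=
    fun t z => M.abs_lossGap_le h (hK _ t.1.2) (hL _ t.2.1.2) (hQ _ t.2.2.2) z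
  have h1 : signAverage (fun (p : (K × L × Q) × (K × L × Q)) i => M.pairGap h p (x i))
      ≤ 2 * signAverage (fun (t : K × L × Q) i => M.lossGap h t.1.1 t.2.1.1 t.2.2.1 (x i)) := by
    have e1 := signAverage_add_le hB
      (u := fun (p : (K × L × Q) × (K × L × Q)) i =>
        M.lossGap h p.1.1.1 p.1.2.1.1 p.1.2.2.1 (x i))
      (v := fun (p : (K × L × Q) × (K × L × Q)) i =>
        -M.lossGap h p.2.1.1 p.2.2.1.1 p.2.2.2.1 (x i))
      (fun p i => hgap p.1 _) (fun p i => by rw [abs_neg]; exact hgap p.2 _)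
    have e2 := signAverage_neg_le (u := fun (p : (K × L × Q) × (K × L × Q)) i =>
      M.lossGap h p.2.1.1 p.2.2.1.1 p.2.2.2.1 (x i)) (fun p i => hgap p.2 _)
    have e3 := signAverage_comp_le (u := fun (t : K × L × Q) i =>
      M.lossGap h t.1.1 t.2.1.1 t.2.2.1 (x i)) hB (fun t i => hgap t _)
      (Prod.fst : (K × L × Q) × (K × L × Q) → _)
    have e4 := signAverage_comp_le (u := fun (t : K × L × Q) i =>
      M.lossGap h t.1.1 t.2.1.1 t.2.2.1 (x i)) hB (fun t i => hgap t _)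
      (Prod.snd : (K × L × Q) × (K × L × Q) → _)
    simp only [← sub_eq_add_neg] at e1
    change signAverage _ ≤ _ at e1
    unfold pairGap
    linarith
  have h2 : signAverage (fun (t : K × L × Q) i => M.lossGap h t.1.1 t.2.1.1 t.2.2.1 (x i))
      ≤ signAverage (fun (t : K × L × Q) i => M.sqLoss h t.1.1 t.2.2.1 (x i))
        + signAverage (fun (t : K × L × Q) i => M.sqLoss h t.2.1.1 t.2.2.1 (x i)) := by
    have e1 := signAverage_add_le hB
      (u := fun (t : K × L × Q) i => M.sqLoss h t.1.1 t.2.2.1 (x i))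
      (v := fun (t : K × L × Q) i => -M.sqLoss h t.2.1.1 t.2.2.1 (x i))
      (fun t i => hloss hK t.1 t.2.2 _) (fun t i => by rw [abs_neg]; exact hloss hL t.2.1 t.2.2 _)
    have e2 := signAverage_neg_le (u := fun (t : K × L × Q) i =>
      M.sqLoss h t.2.1.1 t.2.2.1 (x i)) (fun t i => hloss hL t.2.1 t.2.2 _)
    simp only [← sub_eq_add_neg] at e1
    unfold lossGap
    linarith
  have h3 := M.signAverage_sqLoss_le h hK hQ (fun t : K × L × Q => t.1) (fun t => t.2.2) x
  have h4 := M.signAverage_sqLoss_le h hL hQ (fun t : K × L × Q => t.2.1) (fun t => t.2.2) x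
  linarith

/-- The expected uniform deviation of the loss gaps of one step. -/
lemma integral_uniformDeviation_pairGap_le [IsProbabilityMeasure (μ h)] (hn : 0 < n)
    (hKc : K.Countable) (hLc : L.Countable) (hQc : Q.Countable)
    (hK0 : K.Nonempty) (hL0 : L.Nonempty) (hQ0 : Q.Nonempty)
    (hKm : ∀ f ∈ K, Measurable f) (hLm : ∀ g ∈ L, Measurable g) (hQm : ∀ q ∈ Q, Measurable q)
    (hK : ∀ f ∈ K, ∀ x, |f x| ≤ H) (hL : ∀ g ∈ L, ∀ x, |g x| ≤ H)
    (hQ : ∀ q ∈ Q, ∀ x, |q x| ≤ H) :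
    ∫ x : Fin n → (S × A) × S, uniformDeviation (M.sampleLaw μ h)
        (fun p : (K × L × Q) × (K × L × Q) => M.pairGap h p) x
          ∂(Measure.pi fun _ => M.sampleLaw μ h)
      ≤ 24 * H * (rademacher n (μ h) K + rademacher n (μ h) L
          + 2 * rademacher n (M.nextStateLaw μ h) (greedyValueClass Q)) := by
  have := hK0.to_subtype
  have := hL0.to_subtype
  have := hQ0.to_subtype
  have := hKc.to_subtype
  have := hLc.to_subtype
  have := hQc.to_subtype
  have hH0 : (0 : ℝ) ≤ H := Nat.cast_nonneg H
  have hB : (0 : ℝ) ≤ 18 * (H : ℝ) ^ 2 := by positivity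
  have hVm : ∀ v ∈ greedyValueClass Q, Measurable v := by
    rintro _ ⟨q, hq, rfl⟩
    exact measurable_greedyValue (hQm q hq)
  have hV : ∀ v ∈ greedyValueClass Q, ∀ s, |v s| ≤ H := by
    rintro _ ⟨q, hq, rfl⟩
    exact abs_greedyValue_le (hQ q hq)
  set π : Measure (Fin n → (S × A) × S) := Measure.pi fun _ => M.sampleLaw μ h
  have iK := integrable_empiricalRademacher_comp hKc hK0 hH0 hKm hK π measurable_fst
  have iL := integrable_empiricalRademacher_comp hLc hL0 hH0 hLm hL π measurable_fst
  have iKL : Integrable (fun x : Fin n → (S × A) × S => empiricalRademacher K (fun i => (x i).1)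
      + empiricalRademacher L (fun i => (x i).1)) π := iK.add iL
  have iV := integrable_empiricalRademacher_comp (F := greedyValueClass Q) (hQc.image _) (hQ0.image _) hH0 hVm hV π
    measurable_snd
  have hsym := integral_uniformDeviation_le (M.sampleLaw μ h) hn hB
    (M.measurable_pairGap h hKm hLm hQm) (M.abs_pairGap_le h hK hL hQ)
  have hmono := integral_mono (integrable_signAverage π hB
      (u := fun x (p : (K × L × Q) × (K × L × Q)) i => M.pairGap h p (x i))
      (fun p i => (M.measurable_pairGap h hKm hLm hQm p).comp (measurable_pi_apply i))
      (fun x p i => M.abs_pairGap_le h hK hL hQ p _))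
    ((iKL.add (iV.const_mul 2)).const_mul (12 * H))
    (M.signAverage_pairGap_le h hK0 hL0 hQ0 hK hL hQ)
  have hval : ∫ x : Fin n → (S × A) × S, 12 * H * (empiricalRademacher K (fun i => (x i).1)
          + empiricalRademacher L (fun i => (x i).1)
          + 2 * empiricalRademacher (greedyValueClass Q) (fun i => (x i).2)) ∂π
      = 12 * H * (rademacher n (μ h) K + rademacher n (μ h) L
          + 2 * rademacher n (M.nextStateLaw μ h) (greedyValueClass Q)) := by
    rw [integral_const_mul, integral_add iKL (iV.const_mul 2), integral_add iK iL,
      integral_const_mul,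
      integral_empiricalRademacher_comp hKc hKm (M.measurePreserving_fst_sampleLaw h μ),
      integral_empiricalRademacher_comp hLc hLm (M.measurePreserving_fst_sampleLaw h μ),
      integral_empiricalRademacher_comp (F := greedyValueClass Q) (hQc.image _) hVm (M.measurePreserving_snd_sampleLaw h μ)]
  have hmono' := hmono.trans_eq hval
  linarith

end Pair

/-- The loss gap and its mean are sequentially continuous in the three functions. -/
lemma tendsto_deviation_lossGap [IsProbabilityMeasure (μ h)] {u v w : ℕ → S × A → ℝ}
    {f g q : S × A → ℝ} (hum : ∀ k, Measurable (u k)) (hvm : ∀ k, Measurable (v k))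
    (hwm : ∀ k, Measurable (w k)) (hu : ∀ k x, |u k x| ≤ H) (hv : ∀ k x, |v k x| ≤ H)
    (hw : ∀ k x, |w k x| ≤ H) (huf : ∀ x, Tendsto (fun k => u k x) atTop (𝓝 (f x)))
    (hvg : ∀ x, Tendsto (fun k => v k x) atTop (𝓝 (g x)))
    (hwq : ∀ x, Tendsto (fun k => w k x) atTop (𝓝 (q x))) (x : Fin n → (S × A) × S) :
    Tendsto (fun k => ∫ z, M.lossGap h (u k) (v k) (w k) z ∂(M.sampleLaw μ h)
        - (1 / n : ℝ) * ∑ i, M.lossGap h (u k) (v k) (w k) (x i)) atTop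
      (𝓝 (∫ z, M.lossGap h f g q z ∂(M.sampleLaw μ h)
        - (1 / n : ℝ) * ∑ i, M.lossGap h f g q (x i))) := by
  have hpt : ∀ z, Tendsto (fun k => M.lossGap h (u k) (v k) (w k) z) atTop
      (𝓝 (M.lossGap h f g q z)) := fun z =>
    ((((huf z.1).sub_const _).sub (tendsto_greedyValue hwq z.2)).pow 2).sub
      ((((hvg z.1).sub_const _).sub (tendsto_greedyValue hwq z.2)).pow 2)
  refine Tendsto.sub ?_ ((tendsto_finsetSum _ fun i _ => hpt (x i)).const_mul _)
  exact tendsto_integral_of_dominated_convergence (fun _ => 9 * (H : ℝ) ^ 2)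
    (fun k => (M.measurable_lossGap h (hum k) (hvm k) (hwm k)).aestronglyMeasurable)
    (integrable_const _) (fun k => ae_of_all _ (M.abs_lossGap_le h (hu k) (hv k) (hw k)))
    (ae_of_all _ hpt)

/-- Uniform concentration for one step: the deviations of all pairs of loss gaps are dominated by
a sub-Gaussian statistic whose mean is controlled by the Rademacher complexities. -/
theorem exists_subgaussian_deviation_bound [IsProbabilityMeasure (μ h)] (hn : 0 < n)
    {K L Q : Set (S × A → ℝ)} (hK0 : K.Nonempty) (hL0 : L.Nonempty) (hQ0 : Q.Nonempty)
    (hKp : PointwiseMeasurableClass K) (hLp : PointwiseMeasurableClass L)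
    (hQp : PointwiseMeasurableClass Q) (hK : ∀ f ∈ K, ∀ x, |f x| ≤ H)
    (hL : ∀ g ∈ L, ∀ x, |g x| ≤ H) (hQ : ∀ q ∈ Q, ∀ x, |q x| ≤ H) :
    ∃ (W : (Fin n → (S × A) × S) → ℝ) (m : ℝ),
      HasSubgaussianMGF (fun x => W x - m) (n * ‖36 * (H : ℝ) ^ 2 / n‖₊ ^ 2)
        (Measure.pi fun _ => M.sampleLaw μ h) ∧
      m ≤ 24 * H * (rademacher n (μ h) K + rademacher n (μ h) L
          + 2 * rademacher n (M.nextStateLaw μ h) (greedyValueClass Q)) ∧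
      ∀ x, ∀ f ∈ K, ∀ g ∈ L, ∀ q ∈ Q, ∀ f' ∈ K, ∀ g' ∈ L, ∀ q' ∈ Q,
        (∫ z, M.lossGap h f g q z ∂(M.sampleLaw μ h) - (1 / n : ℝ) * ∑ i, M.lossGap h f g q (x i))
        - (∫ z, M.lossGap h f' g' q' z ∂(M.sampleLaw μ h)
            - (1 / n : ℝ) * ∑ i, M.lossGap h f' g' q' (x i)) ≤ W x := by
  obtain ⟨hKm, K₀, hKs, hKc, hKd⟩ := hKp
  obtain ⟨hLm, L₀, hLs, hLc, hLd⟩ := hLp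
  obtain ⟨hQm, Q₀, hQs, hQc, hQd⟩ := hQp
  have dK : IsPointwiseDense K₀ K := ⟨hKs, hKd⟩
  have dL : IsPointwiseDense L₀ L := ⟨hLs, hLd⟩
  have dQ : IsPointwiseDense Q₀ Q := ⟨hQs, hQd⟩
  have hH0 : (0 : ℝ) ≤ H := Nat.cast_nonneg H
  have hB : (0 : ℝ) ≤ 18 * (H : ℝ) ^ 2 := by positivity
  have hV : ∀ v ∈ greedyValueClass Q, ∀ s, |v s| ≤ H := by
    rintro _ ⟨q, hq, rfl⟩
    exact abs_greedyValue_le (hQ q hq)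
  have nK := dK.nonempty hK0
  have nL := dL.nonempty hL0
  have nQ := dQ.nonempty hQ0
  have := nK.to_subtype
  have := nL.to_subtype
  have := nQ.to_subtype
  have := hKc.to_subtype
  have := hLc.to_subtype
  have := hQc.to_subtype
  have mK : ∀ f ∈ K₀, Measurable f := fun f hf => hKm f (hKs hf)
  have mL : ∀ f ∈ L₀, Measurable f := fun f hf => hLm f (hLs hf)
  have mQ : ∀ f ∈ Q₀, Measurable f := fun f hf => hQm f (hQs hf)
  have bK : ∀ f ∈ K₀, ∀ x, |f x| ≤ H := fun f hf => hK f (hKs hf)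
  have bL : ∀ f ∈ L₀, ∀ x, |f x| ≤ H := fun f hf => hL f (hLs hf)
  have bQ : ∀ f ∈ Q₀, ∀ x, |f x| ≤ H := fun f hf => hQ f (hQs hf)
  set d := fun p : (K₀ × L₀ × Q₀) × (K₀ × L₀ × Q₀) => M.pairGap h p with hd
  have hdm : ∀ p, Measurable (d p) := M.measurable_pairGap h mK mL mQ
  have hdb : ∀ p z, |d p z| ≤ 18 * (H : ℝ) ^ 2 := M.abs_pairGap_le h bK bL bQ
  refine ⟨uniformDeviation (M.sampleLaw μ h) d,
    ∫ x : Fin n → (S × A) × S, uniformDeviation (M.sampleLaw μ h) d x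
      ∂(Measure.pi fun _ => M.sampleLaw μ h), ?_, ?_, ?_⟩
  · refine hasSubgaussianMGF_of_bounded_differences (M.sampleLaw μ h) (C := 2 * (18 * (H : ℝ) ^ 2))
      n _ (measurable_uniformDeviation _ hdm)
      (fun x => abs_iSup_le fun p => abs_deviation_le _ hB (hdb p) x) fun x i z => ?_
    -- Pair gaps are bounded by 18H², so replacing one point moves the supremum by at most 36H²/n.
    refine (abs_uniformDeviation_update_sub_le (M.sampleLaw μ h) hB hdb x i z).trans (le_of_eq ?_)
    ring
  · rw [dK.rademacher_eq hK0 hH0 hK, dL.rademacher_eq hL0 hH0 hL,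
      dQ.greedyValueClass.rademacher_eq (hQ0.image _) hH0 hV]
    exact M.integral_uniformDeviation_pairGap_le h μ hn hKc hLc hQc nK nL nQ mK mL mQ bK bL bQ
  · intro x f hf g hg q hq f' hf' g' hg' q' hq'
    obtain ⟨u, hu, huf⟩ := hKd f hf
    obtain ⟨v, hv, hvg⟩ := hLd g hg
    obtain ⟨w, hw, hwq⟩ := hQd q hq
    obtain ⟨u', hu', huf'⟩ := hKd f' hf'
    obtain ⟨v', hv', hvg'⟩ := hLd g' hg'
    obtain ⟨w', hw', hwq'⟩ := hQd q' hq'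
    -- The statistic is a supremum over the countable classes only; arbitrary triples are reached
    -- along six approximating sequences run with a common index.
    have t1 := M.tendsto_deviation_lossGap h μ (fun k => mK _ (hu k)) (fun k => mL _ (hv k))
      (fun k => mQ _ (hw k)) (fun k => bK _ (hu k)) (fun k => bL _ (hv k)) (fun k => bQ _ (hw k))
      huf hvg hwq x
    have t2 := M.tendsto_deviation_lossGap h μ (fun k => mK _ (hu' k)) (fun k => mL _ (hv' k))
      (fun k => mQ _ (hw' k)) (fun k => bK _ (hu' k)) (fun k => bL _ (hv' k))
      (fun k => bQ _ (hw' k)) huf' hvg' hwq' x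
    refine le_of_tendsto' (t1.sub t2) fun k => ?_
    have hint : ∀ a ∈ K₀, ∀ b ∈ L₀, ∀ c ∈ Q₀,
        Integrable (M.lossGap h a b c) (M.sampleLaw μ h) := fun a ha b hb c hc =>
      Integrable.of_bound (M.measurable_lossGap h (mK a ha) (mL b hb) (mQ c hc)).aestronglyMeasurable
        _ (ae_of_all _ (M.abs_lossGap_le h (bK a ha) (bL b hb) (bQ c hc)))
    refine le_trans (le_of_eq ?_) (le_ciSup (f := fun p =>
        ∫ z, d p z ∂(M.sampleLaw μ h) - (1 / n : ℝ) * ∑ i, d p (x i))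
      (bddAbove_range_of_abs_le fun p => abs_deviation_le _ hB (hdb p) x)
      ((⟨u k, hu k⟩, ⟨v k, hv k⟩, ⟨w k, hw k⟩), (⟨u' k, hu' k⟩, ⟨v' k, hv' k⟩, ⟨w' k, hw' k⟩)))
    simp only [hd, pairGap]
    rw [integral_sub (hint _ (hu k) _ (hv k) _ (hw k)) (hint _ (hu' k) _ (hv' k) _ (hw' k)),
      Finset.sum_sub_distrib]
    ring

end OneStep

end EpisodicMDP

/-! ### Deterministic comparison of the estimator with a competitor. -/

namespace EpisodicMDP

variable {S A : Type*} [MeasurableSpace S] [MeasurableSpace A] [Fintype A] [Nonempty A] {H n : ℕ}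
  (M : EpisodicMDP S A H)

lemma minimaxLoss_eq (d : Fin H → Fin n → (S × A) × S) (f : Fin (H + 1) → S × A → ℝ)
    (g : Fin H → S × A → ℝ) :
    M.minimaxLoss d f g = (1 / H : ℝ) * ∑ h,
      (1 / n : ℝ) * ∑ i, M.lossGap h (f h.castSucc) (g h) (f h.succ) (d h i) := by
  rw [← Finset.mul_sum, ← mul_assoc, minimaxLoss]
  congr 1
  rw [one_div_mul_one_div, mul_comm (n : ℝ)]

lemma bddAbove_minimaxLoss {F : Fin (H + 1) → Set (S × A → ℝ)} {G : Fin H → Set (S × A → ℝ)}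
    (hF : ∀ h, ∀ q ∈ F h, ∀ x, |q x| ≤ H) (hG : ∀ h, ∀ q ∈ G h, ∀ x, |q x| ≤ H)
    (d : Fin H → Fin n → (S × A) × S) {f : Fin (H + 1) → S × A → ℝ} (hf : f ∈ Set.univ.pi F) :
    BddAbove (Set.range fun g : Set.univ.pi G => M.minimaxLoss d f g) := by
  refine ⟨(1 / H : ℝ) * ∑ _h : Fin H, (9 * (H : ℝ) ^ 2), ?_⟩
  rintro _ ⟨⟨g, hg⟩, rfl⟩
  simp only [minimaxLoss_eq]
  refine mul_le_mul_of_nonneg_left (Finset.sum_le_sum fun h _ => ?_) (by positivity)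
  exact (abs_le.1 (abs_mean_le (by positivity) fun i => M.abs_lossGap_le h
    (hF _ _ (hf _ trivial)) (hG _ _ (hg _ trivial)) (hF _ _ (hf _ trivial)) _)).2

/-- The excess Bellman error of a minimax estimator is at most the approximation error plus the
average over the steps of the uniform deviations. -/
lemma bellmanError_le_of_deviation_le (hH : 0 < H) (μ : Fin H → Measure (S × A))
    [∀ h, IsProbabilityMeasure (μ h)]
    {F : Fin (H + 1) → Set (S × A → ℝ)} {G : Fin H → Set (S × A → ℝ)}
    (hG0 : ∀ h, (G h).Nonempty)
    (hFm : ∀ h, ∀ q ∈ F h, Measurable q) (hGm : ∀ h, ∀ q ∈ G h, Measurable q)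
    (hF : ∀ h, ∀ q ∈ F h, ∀ x, |q x| ≤ H) (hG : ∀ h, ∀ q ∈ G h, ∀ x, |q x| ≤ H) {ε : ℝ}
    (hε : ∀ h : Fin H, ∀ q ∈ F h.succ,
      (⨅ g : G h, ∫ x, ((g : S × A → ℝ) x - M.bellman h q x) ^ 2 ∂(μ h)) ≤ ε)
    {d : Fin H → Fin n → (S × A) × S} {w : Fin H → ℝ}
    (hw : ∀ h, ∀ f ∈ F h.castSucc, ∀ g ∈ G h, ∀ q ∈ F h.succ,
      ∀ f' ∈ F h.castSucc, ∀ g' ∈ G h, ∀ q' ∈ F h.succ,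
        (∫ z, M.lossGap h f g q z ∂(M.sampleLaw μ h) - (1 / n : ℝ) * ∑ i, M.lossGap h f g q (d h i))
        - (∫ z, M.lossGap h f' g' q' z ∂(M.sampleLaw μ h)
            - (1 / n : ℝ) * ∑ i, M.lossGap h f' g' q' (d h i)) ≤ w h)
    {fhat f : Fin (H + 1) → S × A → ℝ} (hfhat : M.IsMinimaxEstimator F G d fhat)
    (hf : f ∈ Set.univ.pi F) :
    M.bellmanError μ fhat ≤ M.bellmanError μ f + ε + (1 / H : ℝ) * ∑ h, w h := by
  have hHpos : (0 : ℝ) < H := by exact_mod_cast hH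
  have hGne : Nonempty (Set.univ.pi G) := (Set.univ_pi_nonempty_iff.2 hG0).to_subtype
  have hGne' : ∀ h, Nonempty (G h) := fun h => (hG0 h).to_subtype
  -- Neither the infimum over g nor the supremum over g' need be attained; each near-optimal choice
  -- spends η/2.
  refine le_of_forall_pos_le_add fun η hη => ?_
  have hchoose : ∀ h : Fin H, ∃ g : G h,
      ∫ x, ((g : S × A → ℝ) x - M.bellman h (fhat h.succ) x) ^ 2 ∂(μ h) < ε + η / 2 := fun h =>
    exists_lt_of_ciInf_lt ((hε h _ (hfhat.1 _ trivial)).trans_lt (by linarith))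
  choose g hg using hchoose
  obtain ⟨⟨g', hg'⟩, hsup⟩ := exists_lt_of_lt_ciSup
    (show (⨆ g : Set.univ.pi G, M.minimaxLoss d f g) - η / 2
      < ⨆ g : Set.univ.pi G, M.minimaxLoss d f g by linarith)
  -- The loss of `fhat` against `g` is below its supremum, which minimality puts below the supremum
  -- for `f`, nearly attained at `g'`.
  have hopt : M.minimaxLoss d fhat (fun h => (g h).1) ≤ M.minimaxLoss d f g' + η / 2 := by
    have h1 := le_ciSup (M.bddAbove_minimaxLoss hF hG d hfhat.1)
      ⟨fun h => (g h).1, fun h _ => (g h).2⟩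
    have h2 := hfhat.2 f hf
    simp only at h1 hsup
    linarith
  have hstep : ∀ h : Fin H,
      ∫ x, (fhat h.castSucc x - M.bellman h (fhat h.succ) x) ^ 2 ∂(μ h)
        ≤ ∫ x, (f h.castSucc x - M.bellman h (f h.succ) x) ^ 2 ∂(μ h) + (ε + η / 2) + w h
          + (1 / n : ℝ) * ∑ i, M.lossGap h (fhat h.castSucc) (g h) (fhat h.succ) (d h i)
          - (1 / n : ℝ) * ∑ i, M.lossGap h (f h.castSucc) (g' h) (f h.succ) (d h i) := by
    intro h
    have a1 := hfhat.1 h.castSucc trivial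
    have a2 := hfhat.1 h.succ trivial
    have b1 := hf h.castSucc trivial
    have b2 := hf h.succ trivial
    have c1 := hg' h trivial
    have key := hw h _ a1 _ (g h).2 _ a2 _ b1 _ c1 _ b2
    rw [M.integral_lossGap h μ (hFm _ _ a1) (hGm _ _ (g h).2) (hFm _ _ a2) (hF _ _ a1)
        (hG _ _ (g h).2) (hF _ _ a2),
      M.integral_lossGap h μ (hFm _ _ b1) (hGm _ _ c1) (hFm _ _ b2) (hF _ _ b1)
        (hG _ _ c1) (hF _ _ b2)] at key
    -- The error of `g'` is subtracted in the mean for `f`, so it can be dropped; no approximation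
    -- property of `g'` is needed.
    have hpos : 0 ≤ ∫ x, (g' h x - M.bellman h (f h.succ) x) ^ 2 ∂(μ h) :=
      integral_nonneg fun x => sq_nonneg _
    linarith [hg h]
  have hsum := mul_le_mul_of_nonneg_left (Finset.sum_le_sum fun h (_ : h ∈ Finset.univ) => hstep h)
    (by positivity : (0 : ℝ) ≤ 1 / H)
  simp only [Finset.sum_sub_distrib, Finset.sum_add_distrib, mul_add, mul_sub] at hsum
  rw [minimaxLoss_eq, minimaxLoss_eq] at hopt
  have hconst : (1 / H : ℝ) * (∑ _h : Fin H, ε) + (1 / H : ℝ) * ∑ _h : Fin H, η / 2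
      = ε + η / 2 := by
    rw [Finset.sum_const, Finset.sum_const, Finset.card_univ, Fintype.card_fin, nsmul_eq_mul,
      nsmul_eq_mul]
    field_simp
  simp only [bellmanError]
  linarith

end EpisodicMDP

/-! ### Tail bound and assembly. -/

/-- The tail of a sub-Gaussian random variable, as a measurable event of probability `1 - δ`. -/
lemma ProbabilityTheory.HasSubgaussianMGF.exists_measurableSet_lt {Ω : Type*} [MeasurableSpace Ω]
    {P : Measure Ω} [IsProbabilityMeasure P] {X : Ω → ℝ} {v : NNReal}
    (hX : HasSubgaussianMGF X v P) (hv : 0 < v) {δ : ℝ} (hδ : 0 < δ) (hδ1 : δ < 1) :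
    ∃ E : Set Ω, MeasurableSet E ∧ ENNReal.ofReal (1 - δ) ≤ P E ∧
      ∀ ω ∈ E, X ω < √(2 * v * Real.log (1 / δ)) := by
  have hlog : 0 ≤ Real.log (1 / δ) := Real.log_nonneg (by rw [le_div_iff₀ hδ]; linarith)
  have hv' : (0 : ℝ) < v := hv
  set t := √(2 * v * Real.log (1 / δ))
  have htail : P.real {ω | t ≤ X ω} ≤ δ := by
    refine (hX.measure_ge_le (Real.sqrt_nonneg _)).trans (le_of_eq ?_)
    rw [Real.sq_sqrt (by positivity), neg_div, mul_div_cancel_left₀ _ (by positivity),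
      one_div, Real.log_inv, neg_neg, Real.exp_log hδ]
  -- `X` is only almost everywhere measurable, so the good event is replaced by a measurable subset
  -- of the same probability.
  have hnull : NullMeasurableSet {ω | t ≤ X ω} P :=
    nullMeasurableSet_le aemeasurable_const hX.aemeasurable
  obtain ⟨E, hE, hEm, hEeq⟩ := hnull.compl.exists_measurable_subset_ae_eq
  refine ⟨E, hEm, ?_, fun ω hω => not_le.1 (hE hω)⟩
  rw [measure_congr hEeq, ← ofReal_measureReal, probReal_compl_eq_one_sub₀ hnull]
  exact ENNReal.ofReal_le_ofReal (by linarith)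

theorem theorem5 :
    ∃ c : ℝ, 0 < c ∧
      ∀ (S : Type*) (A : Type*) [MeasurableSpace S] [MeasurableSpace A]
        [Fintype A] [Nonempty A] [MeasurableSingletonClass A]
        (H n : ℕ) (_ : 0 < H) (_ : 0 < n)
        (M : EpisodicMDP S A H)
        (μ : Fin H → Measure (S × A)) (_ : ∀ h, IsProbabilityMeasure (μ h))
        -- the function classes, with values in `[-H, H]`; after the horizon the class is `{0}`
        (F : Fin (H + 1) → Set (S × A → ℝ)) (G : Fin H → Set (S × A → ℝ))
        (_ : ∀ h, (F h).Nonempty) (_ : ∀ h, (G h).Nonempty)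
        (_ : ∀ h, PointwiseMeasurableClass (F h)) (_ : ∀ h, PointwiseMeasurableClass (G h))
        (_ : ∀ h, ∀ q ∈ F h, ∀ x, q x ∈ Set.Icc (-(H : ℝ)) H)
        (_ : ∀ h, ∀ q ∈ G h, ∀ x, q x ∈ Set.Icc (-(H : ℝ)) H)
        (_ : F (Fin.last H) = {0})
        -- approximation of `T_h f_{h+1}` by the helper class
        (ε : ℝ)
        (_ : ∀ h : Fin H, ∀ q ∈ F h.succ,
          (⨅ g : G h, ∫ x, ((g : S × A → ℝ) x - M.bellman h q x) ^ 2 ∂(μ h)) ≤ ε)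
        -- the data: for each step, `n` i.i.d. data points
        (Ω : Type*) [MeasurableSpace Ω] (P : Measure Ω) [IsProbabilityMeasure P]
        (D : Fin H → Fin n → Ω → (S × A) × S)
        (_ : ∀ h i, HasLaw (D h i) (M.sampleLaw μ h) P)
        (_ : ∀ h, iIndepFun (D h) P)
        (δ : ℝ) (_ : 0 < δ) (_ : δ < 1),
        ∃ E : Set Ω, MeasurableSet E ∧ ENNReal.ofReal (1 - δ) ≤ P E ∧
          ∀ ω ∈ E, ∀ fhat : Fin (H + 1) → S × A → ℝ,
            M.IsMinimaxEstimator F G (fun h i => D h i ω) fhat →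
              M.bellmanError μ fhat ≤
                (⨅ f : Set.univ.pi F, M.bellmanError μ f) + ε
                  + c * (H : ℝ) ^ 2 * √(Real.log (1 / δ) / n)
                  + c * ∑ h : Fin H,
                      (rademacher n (μ h) (F h.castSucc) + rademacher n (μ h) (G h)
                        + rademacher n (M.nextStateLaw μ h) (greedyValueClass (F h.succ))) := by
  -- Two demands: 36√2 ≈ 50.9 from the sub-Gaussian tail, and 24 · 2 = 48 from the greedy-value
  -- complexity.
  refine ⟨60, by norm_num, ?_⟩
  intro S A _ _ _ _ _ H n hH hn M μ hμ F G hF0 hG0 hFp hGp hFb hGb hlast ε hε Ω _ P _ D hD hind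
    δ hδ hδ1
  have hHpos : (0 : ℝ) < H := by exact_mod_cast hH
  have hnpos : (0 : ℝ) < n := by exact_mod_cast hn
  have hFin : Nonempty (Fin H) := ⟨⟨0, hH⟩⟩
  have hF : ∀ h, ∀ q ∈ F h, ∀ x, |q x| ≤ H := fun h q hq x => abs_le.2 (hFb h q hq x)
  have hG : ∀ h, ∀ q ∈ G h, ∀ x, |q x| ≤ H := fun h q hq x => abs_le.2 (hGb h q hq x)
  choose W m hsub hm hW using fun h : Fin H => M.exists_subgaussian_deviation_bound h μ hn
    (hF0 h.castSucc) (hG0 h) (hF0 h.succ) (hFp _) (hGp _) (hFp _) (hF _) (hG _) (hF _)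
  set v : NNReal := n * ‖36 * (H : ℝ) ^ 2 / n‖₊ ^ 2 with hv
  have hvreal : (v : ℝ) = n * (36 * (H : ℝ) ^ 2 / n) ^ 2 := by
    rw [hv]
    push_cast
    rw [Real.norm_eq_abs, sq_abs]
  have hvpos : 0 < v := by
    have : (0 : ℝ) < v := by rw [hvreal]; positivity
    exact_mod_cast this
  have hX : ∀ h, HasSubgaussianMGF (fun ω => W h (fun i => D h i ω) - m h) v P := by
    intro h
    have hlaw := iIndepFun.hasLaw_pi (hD h) (hind h)
    refine HasSubgaussianMGF.of_map (X := fun x => W h x - m h) hlaw.aemeasurable ?_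
    rw [hlaw.map_eq]
    exact hsub h
  obtain ⟨E, hEm, hEP, hE⟩ :=
    -- One event serves all steps at once; independence has been used only within a step.
    (HasSubgaussianMGF.average hX).exists_measurableSet_lt hvpos hδ hδ1
  refine ⟨E, hEm, hEP, fun ω hω fhat hfhat => ?_⟩
  have hdev := hE ω hω
  have hlog : 0 ≤ Real.log (1 / δ) := Real.log_nonneg (by rw [le_div_iff₀ hδ]; linarith)
  have hsqrt : √(2 * v * Real.log (1 / δ)) ≤ 60 * (H : ℝ) ^ 2 * √(Real.log (1 / δ) / n) := by
    refine Real.sqrt_le_iff.2 ⟨by positivity, ?_⟩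
    rw [mul_pow, Real.sq_sqrt (by positivity), hvreal]
    have h1 : 2 * (n * (36 * (H : ℝ) ^ 2 / n) ^ 2) * Real.log (1 / δ)
        = 2592 * ((H : ℝ) ^ 4 * (Real.log (1 / δ) / n)) := by
      field_simp
      ring
    have h2 : (60 * (H : ℝ) ^ 2) ^ 2 * (Real.log (1 / δ) / n)
        = 3600 * ((H : ℝ) ^ 4 * (Real.log (1 / δ) / n)) := by ring
    rw [h1, h2]
    exact mul_le_mul_of_nonneg_right (by norm_num) (by positivity)
  have hmean : (1 / H : ℝ) * ∑ h, m h ≤ 60 * ∑ h : Fin H,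
      (rademacher n (μ h) (F h.castSucc) + rademacher n (μ h) (G h)
        + rademacher n (M.nextStateLaw μ h) (greedyValueClass (F h.succ))) := by
    rw [Finset.mul_sum, Finset.mul_sum]
    refine Finset.sum_le_sum fun h _ => ?_
    -- Nonnegativity allows the unequal coefficients 24, 24, 48 to be raised to a common 60.
    have p1 := rademacher_nonneg (hF0 h.castSucc) (hF _) n (μ h)
    have p2 := rademacher_nonneg (hG0 h) (hG _) n (μ h)
    have p3 := rademacher_nonneg (F := greedyValueClass (F h.succ)) ((hF0 h.succ).image _)
      (by rintro _ ⟨q, hq, rfl⟩; exact abs_greedyValue_le (hF _ q hq)) n (M.nextStateLaw μ h)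
    refine (mul_le_mul_of_nonneg_left (hm h) (by positivity : (0 : ℝ) ≤ 1 / H)).trans ?_
    rw [← mul_assoc, show (1 / H : ℝ) * (24 * H) = 24 by field_simp]
    linarith
  have hFne : Nonempty (Set.univ.pi F) := (Set.univ_pi_nonempty_iff.2 hF0).to_subtype
  -- The statistics do not depend on the comparator, so on the same event the bound holds for every
  -- `f` and passes to the infimum.
  have hinf : M.bellmanError μ fhat - ε - (1 / H : ℝ) * ∑ h, W h (fun i => D h i ω)
      ≤ ⨅ f : Set.univ.pi F, M.bellmanError μ f := by
    refine le_ciInf fun f => ?_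
    have := M.bellmanError_le_of_deviation_le hH μ hG0 (fun h => (hFp h).1) (fun h => (hGp h).1)
      hF hG hε (fun h => hW h fun i => D h i ω) hfhat f.2
    linarith
  rw [Fintype.card_fin, Finset.sum_sub_distrib, mul_sub] at hdev
  linarith
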